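/- **Setting.** Locally convex spaces are real and Hausdorff. A map $f : U \to F$ from an open subset $U$ of a locally convex space $E$ to a locally convex space $F$ is *smooth* if all iterated directional derivatives $(x,h_1,\dots,h_j) \mapsto (\partial_{h_j}\cdots\partial_{h_1}f)(x)$, $j \ge 0$, exist on $U \times E^j$ and are continuous. A *locally convex Lie group* is a group with a smooth manifold structure modelled on a locally convex space for which multiplication and inversion are smooth. Let $G$ be a locally convex Lie group and let $\mathcal H$ be a complex Hilbert space with projective space $\mathbb P(\mathcal H)$, regarded as a Hilbert manifold with the charts $\{[\chi] : \langle\varphi,\chi\rangle\neq 0\} \to \varphi^\perp$, $[\varphi+u]\mapsto u$, for $0 \neq \varphi \in \mathcal H$. Let $\overline\rho : G \to \mathrm{PU}(\mathcal H) = \mathrm U(\mathcal H)/\mathbb T\mathbf 1$ be a projective unitary representation, that is, a group homomorphism (no continuity is assumed), where $\mathbb T = \{z \in \mathbb C : |z| = 1\}$. Let $0 \neq \psi \in \mathcal H$, with ray $[\psi] = \mathbb C\psi$. The ray $[\psi]$ is *smooth* if its orbit map $G \to \mathbb P(\mathcal H)$, $g \mapsto \overline\rho(g)[\psi]$, is smooth.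 The *transition probability* of two rays is $p([\varphi];[\chi]) = |\langle\varphi,\chi\rangle|^2/(\|\varphi\|^2\|\chi\|^2)$. Put $$U_\psi = \{g \in G : p([\psi];\overline\rho(g)[\psi]) \neq 0\}.$$ For $g \in U_\psi$ let $\rho_\psi(g) \in \mathrm U(\mathcal H)$ be the unique unitary operator with class $\overline\rho(g)$ in $\mathrm{PU}(\mathcal H)$ and $\langle\psi,\rho_\psi(g)\psi\rangle > 0$. For $g,h \in G$ with $g,h,gh \in U_\psi$ let $f_\psi(g,h) \in \mathbb T$ be the unique number with $\rho_\psi(g)\rho_\psi(h) = f_\psi(g,h)\,\rho_\psi(gh)$; $f_\psi$ is called the *local cocycle*. **Theorem (Projective smoothness criterion).** The ray $[\psi]$ is smooth for $\overline\rho$ if and only if both of the following hold: 1. the transition probability $G \to \mathbb R$, $g \mapsto p([\psi];\overline\rho(g)[\psi])$, is smooth in a neighbourhood of $\mathbf 1 \in G$; 2. the local cocycle $f_\psi$ is defined and smooth in a neighbourhood of $(\mathbf 1,\mathbf 1) \in G \times G$. Moreover, condition 1 alone already implies that $f_\psi$ is defined on a neighbourhood of $(\mathbf 1,\mathbf 1)$.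 -/

import Mathlib

open Set Filter Topology
open scoped LinearAlgebra.Projectivization

noncomputable section

/-! ## Smooth maps between locally convex spaces -/

section Smooth

/-- `f` has derivative `f'` at `x` in the direction `h`: `(f (x + t h) - f x) / t → f'` as
`t → 0`, `t ≠ 0`. -/
def HasDirDerivAt {E F : Type*} [AddCommGroup E] [Module ℝ E]
    [AddCommGroup F] [Module ℝ F] [TopologicalSpace F]
    (f : E → F) (f' : F) (x h : E) : Prop :=
  Tendsto (fun t : ℝ => t⁻¹ • (f (x + t • h) - f x)) (𝓝[≠] 0) (𝓝 f')

/-- Smoothness of `f` on an open subset `U` of a locally convex space: all iterated directional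
derivatives `D j x (h₁, …, hⱼ) = (∂_{hⱼ} ⋯ ∂_{h₁} f) x` exist at all points of `U`, and each
`D j : U × E ^ j → F` is continuous (for `j = 0` this is the continuity of `f`). Since the target
spaces are Hausdorff and `U` is open, the family `D` is determined by `f` on `U`. -/
def IsSmoothOn {E F : Type*} [AddCommGroup E] [Module ℝ E] [TopologicalSpace E]
    [AddCommGroup F] [Module ℝ F] [TopologicalSpace F]
    (f : E → F) (U : Set E) : Prop :=
  ∃ D : (j : ℕ) → E → (Fin j → E) → F,
    (∀ x ∈ U, ∀ h : Fin 0 → E, D 0 x h = f x) ∧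
    (∀ j, ∀ x ∈ U, ∀ (h : Fin j → E) (v : E),
      HasDirDerivAt (fun y => D j y h) (D (j + 1) x (Fin.snoc (α := fun _ => E) h v)) x v) ∧
    (∀ j, ContinuousOn (fun q : E × (Fin j → E) => D j q.1 q.2) (U ×ˢ univ))

/-- Smoothness of `f : M → N` on an open set `U ⊆ M`, with respect to an atlas `A` of `M` and a
set of charts `B` of `N`: `f` is continuous on `U`, and all its local representatives
`b ∘ f ∘ a⁻¹` are smooth on the (open) subsets of the model space where they are defined. -/
def IsSmoothMapOn {E F M N : Type*} [AddCommGroup E] [Module ℝ E] [TopologicalSpace E]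
    [AddCommGroup F] [Module ℝ F] [TopologicalSpace F] [TopologicalSpace M] [TopologicalSpace N]
    (A : Set (OpenPartialHomeomorph M E)) (B : Set (OpenPartialHomeomorph N F))
    (f : M → N) (U : Set M) : Prop :=
  ContinuousOn f U ∧ ∀ a ∈ A, ∀ b ∈ B,
    IsSmoothOn (b ∘ f ∘ a.symm) (a.target ∩ a.symm ⁻¹' (U ∩ f ⁻¹' b.source))

/-- The product atlas on `M × M`. -/
def prodAtlas {E M : Type*} [TopologicalSpace E] [TopologicalSpace M]
    (A : Set (OpenPartialHomeomorph M E)) : Set (OpenPartialHomeomorph (M × M) (E × E)) :=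
  {e | ∃ a ∈ A, ∃ b ∈ A, e = a.prod b}

/-- A vector space as a manifold, with the identity as its only chart. -/
def vectorAtlas (F : Type*) [TopologicalSpace F] : Set (OpenPartialHomeomorph F F) :=
  {OpenPartialHomeomorph.refl F}

/-- A locally convex Lie group `G` modelled on `E` (used only for `E` a Hausdorff
locally convex real topological vector space): a group that is a smooth manifold modelled on `E`,
such that multiplication and inversion are smooth. -/
class LocallyConvexLieGroup (E G : Type*) [AddCommGroup E] [Module ℝ E] [TopologicalSpace E]
    [TopologicalSpace G] [ChartedSpace E G] [Group G] : Prop where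
  smooth_transition : ∀ a ∈ atlas E G, ∀ b ∈ atlas E G,
    IsSmoothOn (b ∘ a.symm) (a.symm.trans b).source
  smooth_mul : IsSmoothMapOn (prodAtlas (atlas E G)) (atlas E G)
    (fun q : G × G => q.1 * q.2) univ
  smooth_inv : IsSmoothMapOn (atlas E G) (atlas E G) (fun g : G => g⁻¹) univ

end Smooth

/-! ## The projective space of a Hilbert space as a Hilbert manifold -/

section ProjectiveSpace

variable {H : Type*} [NormedAddCommGroup H] [InnerProductSpace ℂ H]

/-- The quotient topology on the projective space. -/
instance projectivizationTopology : TopologicalSpace (ℙ ℂ H) :=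
  TopologicalSpace.coinduced (Projectivization.mk' ℂ) inferInstance

theorem isQuotientMap_mk' : IsQuotientMap (Projectivization.mk' ℂ (V := H)) :=
  ⟨⟨rfl⟩, fun x => ⟨⟨x.rep, x.rep_nonzero⟩, x.mk_rep⟩⟩

/-- The transition probability `|⟨φ, ψ⟩|² / (‖φ‖² ‖ψ‖²)` of two rays `[φ]`, `[ψ]`. -/
def transitionProb (x y : ℙ ℂ H) : ℝ :=
  ‖inner ℂ x.rep y.rep‖ ^ 2 / (‖x.rep‖ ^ 2 * ‖y.rep‖ ^ 2)

theorem transitionProb_mk (φ ψ : H) (hφ : φ ≠ 0) (hψ : ψ ≠ 0) :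
    transitionProb (.mk ℂ φ hφ) (.mk ℂ ψ hψ) = ‖inner ℂ φ ψ‖ ^ 2 / (‖φ‖ ^ 2 * ‖ψ‖ ^ 2) := by
  obtain ⟨a, ha⟩ := Projectivization.exists_smul_eq_mk_rep ℂ φ hφ
  obtain ⟨b, hb⟩ := Projectivization.exists_smul_eq_mk_rep ℂ ψ hψ
  have h1 : ‖(a : ℂ)‖ ≠ 0 := norm_ne_zero_iff.2 a.ne_zero
  have h2 : ‖(b : ℂ)‖ ≠ 0 := norm_ne_zero_iff.2 b.ne_zero
  have h3 := norm_ne_zero_iff.2 hφ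
  have h4 := norm_ne_zero_iff.2 hψ
  simp only [transitionProb, ← ha, ← hb, Units.smul_def, inner_smul_left, inner_smul_right,
    norm_mul, norm_smul, RCLike.norm_conj]
  field_simp

/-- The affine coordinate `[φ + u] ↦ u`, where `u ⊥ φ`; that is,
`[χ] ↦ (‖φ‖² / ⟨φ, χ⟩) χ - φ`, which is the component orthogonal to `φ` of the first term. -/
def affineCoord (φ : H) (x : ℙ ℂ H) : (ℂ ∙ φ)ᗮ :=
  (ℂ ∙ φ)ᗮ.orthogonalProjectionOnto (((‖φ‖ : ℂ) ^ 2 / inner ℂ φ x.rep) • x.rep)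

theorem affineCoord_mk (φ χ : H) (hχ : χ ≠ 0) : affineCoord φ (.mk ℂ χ hχ) =
    (ℂ ∙ φ)ᗮ.orthogonalProjectionOnto (((‖φ‖ : ℂ) ^ 2 / inner ℂ φ χ) • χ) := by
  obtain ⟨a, ha⟩ := Projectivization.exists_smul_eq_mk_rep ℂ χ hχ
  have h1 : (a : ℂ) ≠ 0 := a.ne_zero
  simp only [affineCoord, ← ha, Units.smul_def, inner_smul_right, smul_smul]
  congr 2
  by_cases h : inner ℂ φ χ = 0
  · simp [h]
  · field_simp

theorem inner_rep_eq_zero_iff (φ χ : H) (hχ : χ ≠ 0) :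
    inner ℂ φ (Projectivization.mk ℂ χ hχ).rep = 0 ↔ inner ℂ φ χ = 0 := by
  obtain ⟨a, ha⟩ := Projectivization.exists_smul_eq_mk_rep ℂ χ hχ
  simp [← ha, Units.smul_def]

theorem add_orthogonal_ne_zero {φ : H} (hφ : φ ≠ 0) (u : (ℂ ∙ φ)ᗮ) : φ + (u : H) ≠ 0 := by
  intro h
  have h1 : inner ℂ φ (u : H) = 0 := Submodule.mem_orthogonal_singleton_iff_inner_right.1 u.2
  have h2 : inner ℂ φ (φ + (u : H)) = 0 := by rw [h, inner_zero_right]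
  rw [inner_add_right, h1, add_zero, inner_self_eq_zero] at h2
  exact hφ h2

theorem inner_add_orthogonal (φ : H) (u : (ℂ ∙ φ)ᗮ) :
    inner ℂ φ (φ + (u : H)) = (‖φ‖ : ℂ) ^ 2 := by
  have h1 : inner ℂ φ (u : H) = 0 := Submodule.mem_orthogonal_singleton_iff_inner_right.1 u.2
  rw [inner_add_right, h1, add_zero, inner_self_eq_norm_sq_to_K]
  rfl

theorem affineCoord_apply {φ χ : H} (hχ : χ ≠ 0) (h : inner ℂ φ χ ≠ 0) :
    (affineCoord φ (.mk ℂ χ hχ) : H) = ((‖φ‖ : ℂ) ^ 2 / inner ℂ φ χ) • χ - φ := by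
  rw [affineCoord_mk]
  have hmem : ((‖φ‖ : ℂ) ^ 2 / inner ℂ φ χ) • χ - φ ∈ (ℂ ∙ φ)ᗮ := by
    rw [Submodule.mem_orthogonal_singleton_iff_inner_right, inner_sub_right, inner_smul_right,
      div_mul_cancel₀ _ h, inner_self_eq_norm_sq_to_K]
    exact sub_self _
  have h2 : (ℂ ∙ φ)ᗮ.orthogonalProjectionOnto φ = 0 :=
    Submodule.orthogonalProjectionOnto_orthogonal_apply_eq_zero (Submodule.mem_span_singleton_self φ)
  have h3 := Submodule.orthogonalProjectionOnto_mem_subspace_eq_self (K := (ℂ ∙ φ)ᗮ) ⟨_, hmem⟩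
  simp only [map_sub, h2, sub_zero] at h3
  rw [h3]

/-- The standard chart `{[χ] | ⟨φ, χ⟩ ≠ 0} = {[φ + u] | u ⊥ φ} → φᗮ`, `[φ + u] ↦ u`, of the
projective space. These charts, for all `φ ≠ 0`, are the standard atlas. -/
def projChart (φ : {v : H // v ≠ 0}) : OpenPartialHomeomorph (ℙ ℂ H) (ℂ ∙ (φ : H))ᗮ where
  toFun := affineCoord (φ : H)
  invFun u := .mk ℂ ((φ : H) + u) (add_orthogonal_ne_zero φ.2 u)
  source := {x | inner ℂ (φ : H) x.rep ≠ 0}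
  target := univ
  map_source' _ _ := mem_univ _
  map_target' u _ := by
    rw [mem_ofPred_eq, Ne, inner_rep_eq_zero_iff, inner_add_orthogonal]
    simpa using φ.2
  left_inv' x hx := by
    induction x with
    | h χ hχ =>
    rw [mem_ofPred_eq, Ne, inner_rep_eq_zero_iff] at hx
    rw [Projectivization.mk_eq_mk_iff']
    exact ⟨(‖(φ : H)‖ : ℂ) ^ 2 / inner ℂ (φ : H) χ, by rw [affineCoord_apply hχ hx]; abel⟩
  right_inv' u _ := by
    have h0 : (‖(φ : H)‖ : ℂ) ^ 2 ≠ 0 := by simpa using φ.2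
    ext
    rw [affineCoord_apply _ (by rw [inner_add_orthogonal]; exact h0), inner_add_orthogonal,
      div_self h0, one_smul, add_sub_cancel_left]
  open_source := by
    rw [← isQuotientMap_mk'.isOpen_preimage]
    have : Projectivization.mk' ℂ ⁻¹' {x : ℙ ℂ H | inner ℂ (φ : H) x.rep ≠ 0} =
        {v : {v : H // v ≠ 0} | inner ℂ (φ : H) (v : H) ≠ 0} := by
      ext v
      exact not_congr (inner_rep_eq_zero_iff _ _ v.2)
    rw [this]
    exact isOpen_ne_fun (by fun_prop) continuous_const
  open_target := isOpen_univ
  continuousOn_toFun := by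
    have hop : IsOpen {x : ℙ ℂ H | inner ℂ (φ : H) x.rep ≠ 0} := by
      rw [← isQuotientMap_mk'.isOpen_preimage]
      have : Projectivization.mk' ℂ ⁻¹' {x : ℙ ℂ H | inner ℂ (φ : H) x.rep ≠ 0} =
          {v : {v : H // v ≠ 0} | inner ℂ (φ : H) (v : H) ≠ 0} := by
        ext v
        exact not_congr (inner_rep_eq_zero_iff _ _ v.2)
      rw [this]
      exact isOpen_ne_fun (by fun_prop) continuous_const
    refine (isQuotientMap_mk'.continuousOn_isOpen_iff hop).2 ?_
    have h : ContinuousOn (fun v : {v : H // v ≠ 0} => (ℂ ∙ (φ : H))ᗮ.orthogonalProjectionOnto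
        (((‖(φ : H)‖ : ℂ) ^ 2 / inner ℂ (φ : H) (v : H)) • (v : H)))
        (Projectivization.mk' ℂ ⁻¹' {x : ℙ ℂ H | inner ℂ (φ : H) x.rep ≠ 0}) := by
      apply (ContinuousLinearMap.continuous _).comp_continuousOn
      apply ContinuousOn.smul _ (by fun_prop)
      apply ContinuousOn.div (by fun_prop) (by fun_prop)
      intro v hv
      exact fun h0 => hv ((inner_rep_eq_zero_iff _ _ v.2).2 h0)
    exact h.congr fun v _ => affineCoord_mk _ _ v.2
  continuousOn_invFun := by
    have h : Continuous fun u : (ℂ ∙ (φ : H))ᗮ => Projectivization.mk' ℂ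
        (⟨(φ : H) + u, add_orthogonal_ne_zero φ.2 u⟩ : {v : H // v ≠ 0}) :=
      isQuotientMap_mk'.continuous.comp (by fun_prop)
    exact h.continuousOn

/-- Smoothness on an open set `U` of a map from a manifold with atlas `A` to the (real) Hilbert
manifold `ℙ ℂ H`, tested in all standard charts. -/
def IsSmoothToProjOn {E M : Type*} [AddCommGroup E] [Module ℝ E] [TopologicalSpace E]
    [TopologicalSpace M] (A : Set (OpenPartialHomeomorph M E)) (f : M → ℙ ℂ H) (U : Set M) :
    Prop :=
  ∀ φ : {v : H // v ≠ 0}, IsSmoothMapOn A {projChart φ} f U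

end ProjectiveSpace

/-! ## Projective unitary representations -/

section Representations

variable {H : Type*} [NormedAddCommGroup H] [InnerProductSpace ℂ H]

/-- The scalar unitary operator `z • 1`, `|z| = 1`. -/
def scalarUnitary (H : Type*) [NormedAddCommGroup H] [InnerProductSpace ℂ H] :
    Circle →* (H ≃ₗᵢ[ℂ] H) where
  toFun z :=
    { LinearEquiv.smulOfNeZero ℂ H (z : ℂ) z.coe_ne_zero with
      norm_map' := fun v => by
        change ‖(z : ℂ) • v‖ = ‖v‖
        rw [norm_smul, Circle.norm_coe, one_mul] }
  map_one' := by
    ext v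
    change ((1 : Circle) : ℂ) • v = v
    simp
  map_mul' z w := by
    ext v
    change ((z * w : Circle) : ℂ) • v = (z : ℂ) • (w : ℂ) • v
    rw [Circle.coe_mul, mul_smul]

theorem scalarUnitary_apply (z : Circle) (v : H) : scalarUnitary H z v = (z : ℂ) • v := rfl

/-- The subgroup `𝕋 1` of the unitary group. -/
def scalarSubgroup (H : Type*) [NormedAddCommGroup H] [InnerProductSpace ℂ H] :
    Subgroup (H ≃ₗᵢ[ℂ] H) :=
  (scalarUnitary H).range

instance scalarSubgroup_normal : (scalarSubgroup H).Normal where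
  conj_mem := by
    rintro _ ⟨z, rfl⟩ U
    refine ⟨z, ?_⟩
    ext v
    change (z : ℂ) • v = U ((z : ℂ) • U⁻¹ v)
    rw [map_smul]
    congr 1
    exact (U.apply_symm_apply v).symm

/-- The projective unitary group `PU(H) = U(H) / 𝕋 1`. -/
abbrev ProjUnitary (H : Type*) [NormedAddCommGroup H] [InnerProductSpace ℂ H] : Type _ :=
  (H ≃ₗᵢ[ℂ] H) ⧸ scalarSubgroup H

/-- The action of a unitary operator on rays, `U [ψ] = [U ψ]`. -/
def unitaryAct (U : H ≃ₗᵢ[ℂ] H) (x : ℙ ℂ H) : ℙ ℂ H :=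
  x.map (U.toLinearEquiv : H →ₗ[ℂ] H) U.injective

/-- The action of the projective unitary group on rays. -/
def projAct (u : ProjUnitary H) (x : ℙ ℂ H) : ℙ ℂ H :=
  Quotient.liftOn' u (fun U => unitaryAct U x) (by
    intro U V hUV
    rw [QuotientGroup.leftRel_apply] at hUV
    obtain ⟨z, hz⟩ := hUV
    have hV : V = U * scalarUnitary H z := by rw [hz]; group
    subst hV
    induction x with
    | h χ hχ =>
    refine ((Projectivization.mk_eq_mk_iff' ℂ _ _ _ _).2 ⟨((z⁻¹ : Circle) : ℂ), ?_⟩)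
    change ((z⁻¹ : Circle) : ℂ) • U ((z : ℂ) • χ) = U χ
    rw [map_smul, smul_smul, ← Circle.coe_mul]
    simp)

theorem projAct_mk (U : H ≃ₗᵢ[ℂ] H) (χ : H) (hχ : χ ≠ 0) :
    projAct (U : ProjUnitary H) (.mk ℂ χ hχ) =
      .mk ℂ (U χ) (by simpa using hχ) := rfl

variable {G : Type*} [Group G]

/-- The ray `x` is smooth for `ρ`: its orbit map `G → ℙ ℂ H`, `g ↦ ρ(g) x` is smooth. -/
def IsSmoothRay (E : Type*) [AddCommGroup E] [Module ℝ E] [TopologicalSpace E]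
    [TopologicalSpace G] [ChartedSpace E G] (ρ : G →* ProjUnitary H) (x : ℙ ℂ H) : Prop :=
  IsSmoothToProjOn (atlas E G) (fun g => projAct (ρ g) x) univ

/-- `U` is a normalised lift of `ρ(g)`: its class is `ρ(g)` and `⟨ψ, U ψ⟩ > 0`. -/
def IsNormalizedLift (ρ : G →* ProjUnitary H) (ψ : H) (g : G) (U : H ≃ₗᵢ[ℂ] H) : Prop :=
  (U : ProjUnitary H) = ρ g ∧ 0 < (inner ℂ ψ (U ψ)).re ∧ (inner ℂ ψ (U ψ)).im = 0

/-- The set of all `g` such that `ρ(g)[ψ]` is not orthogonal to `[ψ]`. -/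
def liftDomain (ρ : G →* ProjUnitary H) (ψ : H) (hψ : ψ ≠ 0) : Set G :=
  {g | transitionProb (.mk ℂ ψ hψ) (projAct (ρ g) (.mk ℂ ψ hψ)) ≠ 0}

theorem coe_eq_coe_iff (U V : H ≃ₗᵢ[ℂ] H) :
    (U : ProjUnitary H) = V ↔ ∃ z : Circle, V = scalarUnitary H z * U := by
  rw [eq_comm, QuotientGroup.eq_iff_div_mem]
  constructor
  · rintro ⟨z, hz⟩
    exact ⟨z, by rw [hz, div_mul_cancel]⟩
  · rintro ⟨z, rfl⟩
    exact ⟨z, (mul_div_cancel_right _ _).symm⟩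

theorem existsUnique_normalizedLift (ρ : G →* ProjUnitary H) (ψ : H) (hψ : ψ ≠ 0) (g : G)
    (hg : g ∈ liftDomain ρ ψ hψ) : ∃! U, IsNormalizedLift ρ ψ g U := by
  obtain ⟨U, hU⟩ := QuotientGroup.mk_surjective (ρ g)
  have hc : inner ℂ ψ (U ψ) ≠ 0 := by
    intro h0
    apply hg
    rw [← hU, projAct_mk, transitionProb_mk, h0]
    simp
  set c : ℂ := inner ℂ ψ (U ψ) with hcdef
  have hn : (0 : ℝ) < ‖c‖ := norm_pos_iff.2 hc
  have hn' : (‖c‖ : ℂ) ≠ 0 := by exact_mod_cast hn.ne'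
  have hinner : ∀ z : Circle, inner ℂ ψ ((scalarUnitary H z * U) ψ) = (z : ℂ) * c := by
    intro z
    change inner ℂ ψ ((z : ℂ) • U ψ) = _
    rw [inner_smul_right]
  let z : Circle := ⟨(starRingEnd ℂ) c / ‖c‖, by
    change _ ∈ Metric.sphere (0 : ℂ) 1
    rw [mem_sphere_zero_iff_norm, norm_div, RCLike.norm_conj, Complex.norm_real, norm_norm,
      div_self hn.ne']⟩
  have hz : (z : ℂ) * c = ‖c‖ := by
    change (starRingEnd ℂ) c / ‖c‖ * c = ‖c‖
    rw [div_mul_eq_mul_div, Complex.conj_mul']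
    field_simp
  refine ⟨scalarUnitary H z * U, ⟨?_, ?_, ?_⟩, ?_⟩
  · rw [← hU, eq_comm]
    exact (coe_eq_coe_iff _ _).2 ⟨z, rfl⟩
  · rw [hinner, hz]; simpa using hc
  · rw [hinner, hz]; simp
  · rintro V ⟨hV, hre, him⟩
    obtain ⟨w, rfl⟩ := (coe_eq_coe_iff U V).1 (hU.trans hV.symm)
    rw [hinner] at hre him
    have h1 : (w : ℂ) * c = (((w : ℂ) * c).re : ℂ) := Complex.ext (by simp) (by simpa using him)
    have h2 : ((w : ℂ) * c).re = ‖c‖ := by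
      have h3 : ‖(w : ℂ) * c‖ = ‖c‖ := by rw [norm_mul, Circle.norm_coe, one_mul]
      rw [h1, Complex.norm_real, Real.norm_of_nonneg hre.le] at h3
      exact h3
    have h4 : (w : ℂ) = z := mul_right_cancel₀ hc (by rw [hz, h1, h2])
    rw [Circle.ext h4]

open Classical in
/-- `ρ_ψ(g)`, the unique unitary lift of `ρ(g)` with `⟨ψ, ρ_ψ(g) ψ⟩ > 0`. It is only meaningful
for `g` in `liftDomain`, and has an irrelevant value elsewhere. -/
def normalizedLift (ρ : G →* ProjUnitary H) (ψ : H) (g : G) : H ≃ₗᵢ[ℂ] H :=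
  if h : ∃ U, IsNormalizedLift ρ ψ g U then h.choose else 1

theorem normalizedLift_spec (ρ : G →* ProjUnitary H) (ψ : H) (hψ : ψ ≠ 0) (g : G)
    (hg : g ∈ liftDomain ρ ψ hψ) : IsNormalizedLift ρ ψ g (normalizedLift ρ ψ g) := by
  have h := (existsUnique_normalizedLift ρ ψ hψ g hg).exists
  rw [normalizedLift, dif_pos h]
  exact h.choose_spec

/-- The pairs `(g, h)` for which `ρ_ψ(g)`, `ρ_ψ(h)` and `ρ_ψ(gh)` are defined. -/
def cocycleDomain (ρ : G →* ProjUnitary H) (ψ : H) (hψ : ψ ≠ 0) : Set (G × G) :=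
  {q | q.1 ∈ liftDomain ρ ψ hψ ∧ q.2 ∈ liftDomain ρ ψ hψ ∧ q.1 * q.2 ∈ liftDomain ρ ψ hψ}

theorem existsUnique_cocycle (ρ : G →* ProjUnitary H) (ψ : H) (hψ : ψ ≠ 0) (q : G × G)
    (hq : q ∈ cocycleDomain ρ ψ hψ) :
    ∃! z : Circle, normalizedLift ρ ψ q.1 * normalizedLift ρ ψ q.2 =
      scalarUnitary H z * normalizedLift ρ ψ (q.1 * q.2) := by
  obtain ⟨h1, h2, h3⟩ := hq
  have e1 := (normalizedLift_spec ρ ψ hψ _ h1).1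
  have e2 := (normalizedLift_spec ρ ψ hψ _ h2).1
  have e3 := (normalizedLift_spec ρ ψ hψ _ h3).1
  obtain ⟨z, hz⟩ := (coe_eq_coe_iff (normalizedLift ρ ψ (q.1 * q.2))
    (normalizedLift ρ ψ q.1 * normalizedLift ρ ψ q.2)).1
    (by rw [e3, QuotientGroup.mk_mul, e1, e2, map_mul])
  refine ⟨z, hz, fun w hw => ?_⟩
  have h : scalarUnitary H w = scalarUnitary H z := mul_right_cancel (hw.symm.trans hz)
  have h' : (w : ℂ) • ψ = (z : ℂ) • ψ := by
    rw [← scalarUnitary_apply, h, scalarUnitary_apply]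
  exact Circle.ext (smul_left_injective ℂ hψ h')

open Classical in
/-- The local cocycle `f_ψ : (g, h) ↦ z`, where `ρ_ψ(g) ρ_ψ(h) = z ρ_ψ(gh)`. It is only
meaningful on `cocycleDomain`, and has an irrelevant value elsewhere. -/
def localCocycle (ρ : G →* ProjUnitary H) (ψ : H) (q : G × G) : Circle :=
  if h : ∃ z : Circle, normalizedLift ρ ψ q.1 * normalizedLift ρ ψ q.2 =
      scalarUnitary H z * normalizedLift ρ ψ (q.1 * q.2) then h.choose else 1

theorem localCocycle_spec (ρ : G →* ProjUnitary H) (ψ : H) (hψ : ψ ≠ 0) (q : G × G)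
    (hq : q ∈ cocycleDomain ρ ψ hψ) :
    normalizedLift ρ ψ q.1 * normalizedLift ρ ψ q.2 =
      scalarUnitary H (localCocycle ρ ψ q) * normalizedLift ρ ψ (q.1 * q.2) := by
  have h := (existsUnique_cocycle ρ ψ hψ q hq).exists
  rw [localCocycle, dif_pos h]
  exact h.choose_spec

/-- The transition probability `g ↦ p([ψ]; ρ(g)[ψ])` is smooth in a neighbourhood of `1`. -/
def TransitionProbSmoothNearOne (E : Type*) [AddCommGroup E] [Module ℝ E] [TopologicalSpace E]
    [TopologicalSpace G] [ChartedSpace E G] (ρ : G →* ProjUnitary H) (ψ : H) (hψ : ψ ≠ 0) :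
    Prop :=
  ∃ U : Set G, IsOpen U ∧ 1 ∈ U ∧ IsSmoothMapOn (atlas E G) (vectorAtlas ℝ)
    (fun g => transitionProb (.mk ℂ ψ hψ) (projAct (ρ g) (.mk ℂ ψ hψ))) U

/-- The local cocycle `f_ψ` is defined and smooth in a neighbourhood of `(1, 1)`. Smoothness of
a map into the unit circle, a submanifold of `ℂ`, is smoothness as a map into `ℂ`. -/
def LocalCocycleSmoothNearOne (E : Type*) [AddCommGroup E] [Module ℝ E] [TopologicalSpace E]
    [TopologicalSpace G] [ChartedSpace E G] (ρ : G →* ProjUnitary H) (ψ : H) (hψ : ψ ≠ 0) :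
    Prop :=
  ∃ W : Set (G × G), IsOpen W ∧ (1, 1) ∈ W ∧ W ⊆ cocycleDomain ρ ψ hψ ∧
    IsSmoothMapOn (prodAtlas (atlas E G)) (vectorAtlas ℂ) (fun q => (localCocycle ρ ψ q : ℂ)) W

end Representations

end

set_option linter.unusedSectionVars false

universe u v w

/-! Write v(g) = ρ_ψ(g)ψ. Everything rests on the identity ⟨v(g⁻¹), v(h)⟩ = f_ψ(g, h) ⟨ψ, v(gh)⟩
(`inner_normalizedLift_inv`), which holds because ρ_ψ(g⁻¹) = ρ_ψ(g)⁻¹. Since ⟨ψ, v(g)⟩ is positive,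
it equals ‖ψ‖² √p(g), where p(g) is the transition probability of [ψ] and its image under g
(`IsNormalizedLift.inner_eq_sqrt`).

If p and f_ψ are smooth near the identity, then so is the Gram kernel (g, h) ↦ ⟨v(g), v(h)⟩ =
f_ψ(g⁻¹, h) ‖ψ‖² √p(g⁻¹h). A map into a Hilbert space with a smooth Gram kernel is smooth
(`IsCInf.of_kernel`): the Gram kernel of its difference quotients is a mixed second difference
quotient of the kernel, so the quotients are Cauchy, and the Gram kernel of the derivative is again
smooth. Hence v is smooth near 1, and left translation makes the whole orbit map smooth
(`isSmoothRay_of_normalizedLift`).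

Conversely, v is a smooth function of the orbit map in the chart at ψ (`normalizedLift_apply_eq`),
and the formulas above express p and f_ψ smoothly through v.

The calculus underneath is that of locally convex spaces. The definition by iterated directional
derivatives is replaced by one by iterated tangent maps (`isSmoothOn_iff_isCInf`), which suits
inductions. The analytic tool is the joint convergence of difference quotients
(`tendsto_differenceQuotient`), a consequence of the mean value theorem. -/

theorem HasDirDerivAt.smul_curve {E F : Type*} [AddCommGroup E] [Module ℝ E]
    [AddCommGroup F] [Module ℝ F] [TopologicalSpace F] {f : E → F} {f' : F} {x h : E} {t r : ℝ}
    (ht : t ≠ 0) (hf : HasDirDerivAt f f' (x + (r * t) • h) h) :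
    HasDirDerivAt (fun s : ℝ => t⁻¹ • f (x + (s * t) • h)) f' r 1 := by
  have h1 : Tendsto (fun s : ℝ => s * t) (𝓝[≠] 0) (𝓝[≠] 0) := by
    refine tendsto_nhdsWithin_of_tendsto_nhds_of_eventually_within _ ?_ ?_
    · have : Tendsto (fun s : ℝ => s * t) (𝓝 0) (𝓝 (0 * t)) := by
        exact (continuous_id.mul continuous_const).tendsto 0
      rw [zero_mul] at this
      exact this.mono_left nhdsWithin_le_nhds
    · filter_upwards [self_mem_nhdsWithin] with s hs
      exact mul_ne_zero hs ht
  refine (hf.comp h1).congr fun s => ?_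
  simp only [Function.comp_apply, smul_eq_mul, mul_one, ← smul_sub, smul_smul, mul_inv]
  congr 3
  rw [add_assoc, ← add_smul]
  congr 3
  ring

/-! ### Mean value theorem and joint convergence of difference quotients -/

section MeanValue

variable {F : Type*} [AddCommGroup F] [Module ℝ F] [TopologicalSpace F] [IsTopologicalAddGroup F]
  [ContinuousSMul ℝ F] [LocallyConvexSpace ℝ F]

/-- Mean value theorem for curves in a locally convex space. -/
theorem sub_mem_of_hasDirDerivAt_mem {γ γ' : ℝ → F} {C : Set F} (hC : Convex ℝ C)
    (hC' : IsClosed C) (h : ∀ r ∈ Icc (0 : ℝ) 1, HasDirDerivAt γ (γ' r) r 1)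
    (hmem : ∀ r ∈ Icc (0 : ℝ) 1, γ' r ∈ C) : γ 1 - γ 0 ∈ C := by
  by_contra hn
  -- A continuous functional separating the increment from C reduces the claim to the scalar mean
  -- value theorem.
  obtain ⟨l, u, hl, hu⟩ := geometric_hahn_banach_closed_point hC hC' hn
  have hder : ∀ r ∈ Icc (0 : ℝ) 1, HasDerivAt (fun s => l (γ s)) (l (γ' r)) r := by
    intro r hr
    rw [hasDerivAt_iff_tendsto_slope_zero]
    have h1 := (l.continuous.tendsto (γ' r)).comp (h r hr)
    refine h1.congr fun t => ?_
    simp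
  obtain ⟨c, hc, hc'⟩ := exists_hasDerivAt_eq_slope (fun s => l (γ s)) (fun s => l (γ' s))
    zero_lt_one (fun r hr => (hder r hr).continuousAt.continuousWithinAt)
    (fun r hr => hder r (Ioo_subset_Icc_self hr))
  have h2 := hl _ (hmem c (Ioo_subset_Icc_self hc))
  rw [map_sub] at hu
  simp only [sub_zero, div_one] at hc'
  linarith

/-- Topological vector spaces are regular, so a convex neighbourhood can be taken inside a closed
one and then closed up. The mean value theorem needs sets that are both convex and closed. -/
theorem exists_convex_closed_mem_nhds {y : F} {N : Set F} (hN : N ∈ 𝓝 y) :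
    ∃ C ∈ 𝓝 y, Convex ℝ C ∧ IsClosed C ∧ C ⊆ N := by
  obtain ⟨C, ⟨hC, hCc⟩, hCN⟩ := (closed_nhds_basis y).mem_iff.1 hN
  obtain ⟨V, ⟨hV, hVc⟩, hVC⟩ := (LocallyConvexSpace.convex_basis (𝕜 := ℝ) y).mem_iff.1 hC
  exact ⟨closure V, mem_of_superset hV subset_closure, hVc.closure, isClosed_closure,
    (closure_minimal hVC hCc).trans hCN⟩

variable {E : Type*} [AddCommGroup E] [Module ℝ E] [TopologicalSpace E] [IsTopologicalAddGroup E]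
  [ContinuousSMul ℝ E]

/-- Difference quotients converge jointly in the base point, the direction, the increment and an
additional parameter. -/
theorem tendsto_differenceQuotient {P : Type*} {l : Filter P} {f : P → E → F} {df : P → E → E → F}
    {x₀ h₀ : E} {L : F}
    (hd : ∀ᶠ q in l ×ˢ 𝓝 (x₀, h₀), HasDirDerivAt (f q.1) (df q.1 q.2.1 q.2.2) q.2.1 q.2.2)
    (hc : Tendsto (fun q : P × E × E => df q.1 q.2.1 q.2.2) (l ×ˢ 𝓝 (x₀, h₀)) (𝓝 L)) :
    Tendsto (fun q : (P × E × E) × ℝ =>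
        q.2⁻¹ • (f q.1.1 (q.1.2.1 + q.2 • q.1.2.2) - f q.1.1 q.1.2.1))
      ((l ×ˢ 𝓝 (x₀, h₀)) ×ˢ 𝓝[≠] 0) (𝓝 L) := by
  intro N hN
  obtain ⟨C, hC, hCconv, hCcl, hCN⟩ := exists_convex_closed_mem_nhds hN
  have h1 := hd.and (hc hC)
  rw [eventually_prod_iff] at h1
  obtain ⟨p, hp, r, hr, hpr⟩ := h1
  -- The whole segment from x to x + t h must stay in the good region. The unpunctured filter is
  -- needed because its initial point has increment 0.
  have h2 : ∀ᶠ q : (E × E) × ℝ in 𝓝 (x₀, h₀) ×ˢ 𝓝 0, r (q.1.1 + q.2 • q.1.2, q.1.2) := by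
    rw [← nhds_prod_eq]
    have hcont : Continuous fun q : (E × E) × ℝ => (q.1.1 + q.2 • q.1.2, q.1.2) := by fun_prop
    have := hcont.tendsto ((x₀, h₀), 0)
    simp only [zero_smul, add_zero] at this
    exact this.eventually hr
  rw [eventually_prod_iff] at h2
  obtain ⟨a, ha, b, hb, hab⟩ := h2
  obtain ⟨ε, hε, hball⟩ := Metric.eventually_nhds_iff_ball.1 hb
  have h3 : ∀ᶠ t : ℝ in 𝓝[≠] 0, t ∈ Metric.ball (0 : ℝ) ε ∧ t ≠ 0 := by
    have h5 : ∀ᶠ t : ℝ in 𝓝[≠] 0, t ∈ Metric.ball (0 : ℝ) ε :=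
      nhdsWithin_le_nhds (Metric.ball_mem_nhds _ hε)
    exact h5.and self_mem_nhdsWithin
  have h4 : ∀ᶠ q : (P × E × E) × ℝ in (l ×ˢ 𝓝 (x₀, h₀)) ×ˢ 𝓝[≠] 0,
      (p q.1.1 ∧ a q.1.2) ∧ (q.2 ∈ Metric.ball (0 : ℝ) ε ∧ q.2 ≠ 0) :=
    (hp.prod_mk ha).prod_mk h3
  rw [mem_map]
  filter_upwards [h4]
  rintro ⟨⟨y, x, h⟩, t⟩ ⟨⟨hy, hxh⟩, ht, ht0⟩
  apply hCN
  have key : ∀ s ∈ Icc (0 : ℝ) 1, r (x + (s * t) • h, h) := by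
    intro s hs
    refine hab hxh (y := s * t) (hball _ ?_)
    rw [mem_ball_zero_iff, norm_mul, Real.norm_of_nonneg hs.1]
    rw [mem_ball_zero_iff] at ht
    exact (mul_le_of_le_one_left (norm_nonneg t) hs.2).trans_lt ht
  -- The increment of this rescaled curve over [0, 1] is the difference quotient, and its derivative
  -- is the directional derivative along the segment.
  have := sub_mem_of_hasDirDerivAt_mem hCconv hCcl
    (γ := fun s : ℝ => t⁻¹ • f y (x + (s * t) • h)) (γ' := fun s => df y (x + (s * t) • h) h)
    (fun s hs => ((hpr hy (key s hs)).1).smul_curve ht0) (fun s hs => (hpr hy (key s hs)).2)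
  simpa [smul_sub] using this

end MeanValue

/-! ### Differentiability by iterated tangent maps -/

/-- `f` is `k` times continuously differentiable on `U`, in terms of iterated tangent maps: `f` is
continuous, and if `k > 0` its directional derivative `(x, h) ↦ df (x, h)` exists and is `k - 1`
times continuously differentiable on `U × E`. -/
def IsCk {F : Type w} [AddCommGroup F] [Module ℝ F] [TopologicalSpace F] :
    ℕ → ∀ {E : Type u} [AddCommGroup E] [Module ℝ E] [TopologicalSpace E], (E → F) → Set E → Prop
  | 0, _, _, _, _, f, U => ContinuousOn f U
  | k + 1, E, _, _, _, f, U => ContinuousOn f U ∧ ∃ df : E × E → F,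
      (∀ x ∈ U, ∀ h, HasDirDerivAt f (df (x, h)) x h) ∧ IsCk k df (U ×ˢ univ)

/-- `f` is `k` times continuously differentiable on `U` for all `k`. -/
def IsCInf {E : Type u} {F : Type w} [AddCommGroup E] [Module ℝ E] [TopologicalSpace E]
    [AddCommGroup F] [Module ℝ F] [TopologicalSpace F] (f : E → F) (U : Set E) : Prop :=
  ∀ k, IsCk k f U

section Basic

variable {E : Type u} [AddCommGroup E] [Module ℝ E] [TopologicalSpace E]
  {F : Type w} [AddCommGroup F] [Module ℝ F] [TopologicalSpace F]

theorem IsCk.continuousOn {k : ℕ} {f : E → F} {U : Set E} (hf : IsCk k f U) :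
    ContinuousOn f U := by
  cases k with
  | zero => exact hf
  | succ k => exact hf.1

theorem IsCk.of_succ {k : ℕ} : ∀ {E : Type u} [AddCommGroup E] [Module ℝ E] [TopologicalSpace E]
    {f : E → F} {U : Set E}, IsCk (k + 1) f U → IsCk k f U := by
  induction k with
  | zero => intro E _ _ _ f U hf; exact hf.1
  | succ k ih =>
    rintro E _ _ _ f U ⟨hc, df, hd, hdf⟩
    exact ⟨hc, df, hd, ih hdf⟩

theorem IsCk.mono {k : ℕ} : ∀ {E : Type u} [AddCommGroup E] [Module ℝ E] [TopologicalSpace E]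
    {f : E → F} {U V : Set E}, IsCk k f U → V ⊆ U → IsCk k f V := by
  induction k with
  | zero => intro E _ _ _ f U V hf hV; exact ContinuousOn.mono hf hV
  | succ k ih =>
    rintro E _ _ _ f U V ⟨hc, df, hd, hdf⟩ hV
    exact ⟨hc.mono hV, df, fun x hx => hd x (hV hx), ih hdf (prod_mono_left hV)⟩

theorem IsCInf.mono {f : E → F} {U V : Set E} (hf : IsCInf f U) (hV : V ⊆ U) : IsCInf f V :=
  fun k => (hf k).mono hV

theorem IsCInf.continuousOn {f : E → F} {U : Set E} (hf : IsCInf f U) : ContinuousOn f U :=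
  (hf 0).continuousOn

theorem HasDirDerivAt.unique [T2Space F] {f : E → F} {a b : F} {x h : E}
    (ha : HasDirDerivAt f a x h) (hb : HasDirDerivAt f b x h) : a = b :=
  tendsto_nhds_unique ha hb

theorem hasDirDerivAt_linear (L : E →ₗ[ℝ] F) (x h : E) : HasDirDerivAt L (L h) x h := by
  refine Tendsto.congr' ?_ tendsto_const_nhds
  filter_upwards [self_mem_nhdsWithin] with t ht
  rw [map_add, add_sub_cancel_left, map_smul, smul_smul, inv_mul_cancel₀ ht, one_smul]

theorem HasDirDerivAt.prodMk {F' : Type*} [AddCommGroup F'] [Module ℝ F'] [TopologicalSpace F']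
    {f : E → F} {g : E → F'} {a : F} {b : F'} {x h : E} (hf : HasDirDerivAt f a x h)
    (hg : HasDirDerivAt g b x h) : HasDirDerivAt (fun y => (f y, g y)) (a, b) x h :=
  Tendsto.prodMk_nhds hf hg

variable [IsTopologicalAddGroup E] [ContinuousSMul ℝ E]

theorem tendsto_add_smul (x h : E) : Tendsto (fun t : ℝ => x + t • h) (𝓝[≠] 0) (𝓝 x) := by
  have h1 : Continuous fun t : ℝ => x + t • h := by fun_prop
  have h2 := h1.tendsto 0
  simp only [zero_smul, add_zero] at h2
  exact h2.mono_left nhdsWithin_le_nhds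

theorem HasDirDerivAt.congr {f g : E → F} {a : F} {x h : E} (hf : HasDirDerivAt f a x h)
    (hfg : f =ᶠ[𝓝 x] g) : HasDirDerivAt g a x h := by
  refine Tendsto.congr' ?_ hf
  filter_upwards [(tendsto_add_smul x h).eventually hfg] with t ht
  rw [ht, hfg.self_of_nhds]

theorem IsCk.congr {k : ℕ} {f g : E → F} {U : Set E} (hU : IsOpen U) (hf : IsCk k f U)
    (hfg : EqOn f g U) : IsCk k g U := by
  cases k with
  | zero => exact ContinuousOn.congr hf hfg.symm
  | succ k =>
    obtain ⟨hc, df, hd, hdf⟩ := hf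
    exact ⟨hc.congr hfg.symm, df, fun x hx h =>
      (hd x hx h).congr (hfg.eventuallyEq_of_mem (hU.mem_nhds hx)), hdf⟩

theorem IsCInf.congr {f g : E → F} {U : Set E} (hU : IsOpen U) (hf : IsCInf f U)
    (hfg : EqOn f g U) : IsCInf g U :=
  fun k => (hf k).congr hU hfg

/-- Each order k comes with its own derivative map; by uniqueness of limits they all agree on U, so
a single one serves every order. -/
theorem IsCInf.exists_deriv [T2Space F] {f : E → F} {U : Set E} (hU : IsOpen U)
    (hf : IsCInf f U) : ∃ df : E × E → F, (∀ x ∈ U, ∀ h, HasDirDerivAt f (df (x, h)) x h) ∧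
      IsCInf df (U ×ˢ univ) := by
  obtain ⟨-, df, hd, -⟩ := hf 1
  refine ⟨df, hd, fun k => ?_⟩
  obtain ⟨-, dg, hg, hk⟩ := hf (k + 1)
  exact hk.congr (hU.prod isOpen_univ) fun q hq => (hg _ hq.1 q.2).unique (hd _ hq.1 q.2)

/-- Continuous differentiability is a local property. -/
theorem IsCk.of_local [T2Space F] {k : ℕ} : ∀ {E : Type u} [AddCommGroup E] [Module ℝ E]
    [TopologicalSpace E] [IsTopologicalAddGroup E] [ContinuousSMul ℝ E] {f : E → F} {U : Set E},
    IsOpen U → (∀ x ∈ U, ∃ V, IsOpen V ∧ x ∈ V ∧ IsCk k f V) → IsCk k f U := by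
  have key : ∀ {k : ℕ} {E : Type u} [AddCommGroup E] [Module ℝ E] [TopologicalSpace E] {f : E → F}
      {U : Set E}, (∀ x ∈ U, ∃ V, IsOpen V ∧ x ∈ V ∧ IsCk k f V) → ContinuousOn f U := by
    intro k E _ _ _ f U h x hx
    obtain ⟨V, hV, hxV, hf⟩ := h x hx
    exact (hf.continuousOn.continuousAt (hV.mem_nhds hxV)).continuousWithinAt
  induction k with
  | zero => intro E _ _ _ _ _ f U _ h; exact key h
  | succ k ih =>
    intro E _ _ _ _ _ f U hU h
    refine ⟨key h, ?_⟩
    choose! V hV hxV hf using h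
    choose! hc df hd hdf using hf
    -- The derivative at x is read off from the neighbourhood attached to x itself; uniqueness makes
    -- these choices agree with any fixed neighbourhood locally.
    refine ⟨fun q => df q.1 q, fun x hx h => hd x hx x (hxV x hx) h,
      ih (hU.prod isOpen_univ) fun q hq => ?_⟩
    have hq1 : q.1 ∈ U := hq.1
    have hop : IsOpen ((V q.1 ∩ U) ×ˢ (univ : Set E)) :=
      ((hV _ hq1).inter hU).prod isOpen_univ
    refine ⟨(V q.1 ∩ U) ×ˢ univ, hop, ⟨⟨hxV _ hq1, hq1⟩, mem_univ _⟩, ?_⟩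
    refine ((hdf _ hq1).mono (prod_mono_left inter_subset_left)).congr hop fun y hy => ?_
    exact (hd _ hq1 _ hy.1.1 _).unique (hd _ hy.1.2 _ (hxV _ hy.1.2) _)

theorem IsCInf.of_local [T2Space F] {f : E → F} {U : Set E} (hU : IsOpen U)
    (h : ∀ x ∈ U, ∃ V, IsOpen V ∧ x ∈ V ∧ IsCInf f V) : IsCInf f U := by
  intro k
  refine IsCk.of_local hU fun x hx => ?_
  obtain ⟨V, hV, hxV, hf⟩ := h x hx
  exact ⟨V, hV, hxV, hf k⟩

end Basic

section Operations

variable {F : Type w} [AddCommGroup F] [Module ℝ F] [TopologicalSpace F]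

theorem isCInf_const {E : Type u} [AddCommGroup E] [Module ℝ E] [TopologicalSpace E] (c : F)
    (U : Set E) : IsCInf (fun _ : E => c) U := by
  have key : ∀ (k : ℕ) {E : Type u} [AddCommGroup E] [Module ℝ E] [TopologicalSpace E]
      (c : F) (U : Set E), IsCk k (fun _ : E => c) U := by
    intro k
    induction k with
    | zero => intro E _ _ _ c U; exact continuousOn_const
    | succ k ih =>
      intro E _ _ _ c U
      refine ⟨continuousOn_const, fun _ => 0, fun x _ h => ?_, ih 0 _⟩
      unfold HasDirDerivAt
      simpa using tendsto_const_nhds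
  exact fun k => key k c U

theorem ContinuousLinearMap.isCInf {E : Type u} [AddCommGroup E] [Module ℝ E] [TopologicalSpace E]
    (L : E →L[ℝ] F) (U : Set E) : IsCInf L U := by
  have key : ∀ (k : ℕ) {E : Type u} [AddCommGroup E] [Module ℝ E] [TopologicalSpace E]
      (L : E →L[ℝ] F) (U : Set E), IsCk k L U := by
    intro k
    induction k with
    | zero => intro E _ _ _ L U; exact L.continuous.continuousOn
    | succ k ih =>
      intro E _ _ _ L U
      exact ⟨L.continuous.continuousOn, L.comp (ContinuousLinearMap.snd ℝ E E),
        fun x _ h => hasDirDerivAt_linear (L : E →ₗ[ℝ] F) x h, ih _ _⟩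
  exact fun k => key k L U

theorem IsCk.prodMk {F' : Type v} [AddCommGroup F'] [Module ℝ F'] [TopologicalSpace F'] {k : ℕ} :
    ∀ {E : Type u} [AddCommGroup E] [Module ℝ E] [TopologicalSpace E] {f : E → F} {g : E → F'}
    {U : Set E}, IsCk k f U → IsCk k g U → IsCk k (fun x => (f x, g x)) U := by
  induction k with
  | zero => intro E _ _ _ f g U hf hg; exact ContinuousOn.prodMk hf hg
  | succ k ih =>
    rintro E _ _ _ f g U ⟨hfc, df, hfd, hdf⟩ ⟨hgc, dg, hgd, hdg⟩
    exact ⟨hfc.prodMk hgc, fun q => (df q, dg q),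
      fun x hx h => (hfd x hx h).prodMk (hgd x hx h), ih hdf hdg⟩

theorem IsCInf.prodMk {E : Type u} [AddCommGroup E] [Module ℝ E] [TopologicalSpace E]
    {F' : Type v} [AddCommGroup F'] [Module ℝ F'] [TopologicalSpace F'] {f : E → F} {g : E → F'}
    {U : Set E} (hf : IsCInf f U) (hg : IsCInf g U) : IsCInf (fun x => (f x, g x)) U :=
  fun k => (hf k).prodMk (hg k)

theorem IsCk.add [IsTopologicalAddGroup F] {k : ℕ} :
    ∀ {E : Type u} [AddCommGroup E] [Module ℝ E] [TopologicalSpace E] {f g : E → F}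
    {U : Set E}, IsCk k f U → IsCk k g U → IsCk k (fun x => f x + g x) U := by
  induction k with
  | zero => intro E _ _ _ f g U hf hg; exact ContinuousOn.add hf hg
  | succ k ih =>
    rintro E _ _ _ f g U ⟨hfc, df, hfd, hdf⟩ ⟨hgc, dg, hgd, hdg⟩
    refine ⟨hfc.add hgc, fun q => df q + dg q, fun x hx h => ?_, ih hdf hdg⟩
    refine ((hfd x hx h).add (hgd x hx h)).congr fun t => ?_
    rw [← smul_add, add_sub_add_comm]

theorem IsCk.sum [IsTopologicalAddGroup F] {k : ℕ} {E : Type u} [AddCommGroup E] [Module ℝ E]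
    [TopologicalSpace E] {ι : Type*} (s : Finset ι) {f : ι → E → F} {U : Set E}
    (hf : ∀ i ∈ s, IsCk k (f i) U) : IsCk k (fun x => ∑ i ∈ s, f i x) U := by
  classical
  induction s using Finset.induction_on with
  | empty => simpa using isCInf_const (0 : F) U k
  | insert i s hi ih =>
    simp only [Finset.sum_insert hi]
    exact (hf i (Finset.mem_insert_self i s)).add
      (ih fun j hj => hf j (Finset.mem_insert_of_mem hj))

/-- A linear map carries difference quotients to difference quotients exactly, so neither openness
of the domain nor local convexity of the target is required, unlike in the general chain rule. -/
theorem IsCk.comp_clm {k : ℕ} : ∀ {E : Type u} {E' : Type v} [AddCommGroup E] [Module ℝ E]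
    [TopologicalSpace E] [AddCommGroup E'] [Module ℝ E'] [TopologicalSpace E'] {f : E' → F}
    {V : Set E'} (_ : IsCk k f V) (L : E →L[ℝ] E'), IsCk k (f ∘ L) (L ⁻¹' V) := by
  induction k with
  | zero =>
    intro E E' _ _ _ _ _ _ f V hf L
    exact ContinuousOn.comp hf L.continuous.continuousOn (mapsTo_preimage L V)
  | succ k ih =>
    rintro E E' _ _ _ _ _ _ f V ⟨hc, df, hd, hdf⟩ L
    refine ⟨hc.comp L.continuous.continuousOn (mapsTo_preimage L V), df ∘ L.prodMap L,
      fun x hx h => ?_, (ih hdf (L.prodMap L)).mono fun q hq => hq⟩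
    refine Tendsto.congr (fun t => ?_) (hd (L x) hx (L h))
    simp only [Function.comp_apply, map_add, map_smul]

theorem IsCInf.comp_clm {E : Type u} {E' : Type v} [AddCommGroup E] [Module ℝ E]
    [TopologicalSpace E] [AddCommGroup E'] [Module ℝ E'] [TopologicalSpace E'] {f : E' → F}
    {V : Set E'} (hf : IsCInf f V) (L : E →L[ℝ] E') : IsCInf (f ∘ L) (L ⁻¹' V) :=
  fun k => (hf k).comp_clm L

end Operations

/-! ### The chain rule, and smooth maps of normed spaces -/

section ChainRule

variable {F : Type w} [AddCommGroup F] [Module ℝ F] [TopologicalSpace F] [IsTopologicalAddGroup F]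
  [ContinuousSMul ℝ F] [LocallyConvexSpace ℝ F]

theorem tendsto_differenceQuotient_of_continuousOn {E : Type*} [AddCommGroup E] [Module ℝ E]
    [TopologicalSpace E] [IsTopologicalAddGroup E] [ContinuousSMul ℝ E] {f : E → F}
    {df : E × E → F} {U : Set E} (hU : IsOpen U)
    (hd : ∀ x ∈ U, ∀ h, HasDirDerivAt f (df (x, h)) x h)
    (hc : ContinuousOn df (U ×ˢ univ)) {x : E} (hx : x ∈ U) (h : E) :
    Tendsto (fun q : (E × E) × ℝ => q.2⁻¹ • (f (q.1.1 + q.2 • q.1.2) - f q.1.1))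
      (𝓝 (x, h) ×ˢ 𝓝[≠] 0) (𝓝 (df (x, h))) := by
  have hsnd : Tendsto (Prod.snd : Unit × E × E → E × E) (pure () ×ˢ 𝓝 (x, h)) (𝓝 (x, h)) :=
    tendsto_snd
  have h1 := tendsto_differenceQuotient (P := Unit) (l := pure ()) (f := fun _ => f)
    (df := fun _ y k => df (y, k)) (x₀ := x) (h₀ := h) (L := df (x, h))
    (hsnd.eventually ((continuous_fst.tendsto (x, h)).eventually
      ((hU.eventually_mem hx).mono fun y hy => hd y hy) |>.mono fun q hq => hq q.2))
    (((hc.continuousAt ((hU.prod isOpen_univ).mem_nhds ⟨hx, mem_univ h⟩)).tendsto).comp hsnd)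
  have h2 : Tendsto (fun q : (E × E) × ℝ => (((), q.1), q.2))
      (𝓝 (x, h) ×ˢ 𝓝[≠] 0) ((pure () ×ˢ 𝓝 (x, h)) ×ˢ 𝓝[≠] 0) := by
    refine Tendsto.prodMk (Tendsto.prodMk ?_ tendsto_fst) tendsto_snd
    exact tendsto_pure.2 (Eventually.of_forall fun _ => rfl)
  exact h1.comp h2

/-- A directional derivative that is jointly continuous is additive in the direction. -/
theorem hasDirDerivAt_add {E : Type*} [AddCommGroup E] [Module ℝ E]
    [TopologicalSpace E] [IsTopologicalAddGroup E] [ContinuousSMul ℝ E] {f : E → F}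
    {df : E × E → F} {U : Set E} (hU : IsOpen U)
    (hd : ∀ x ∈ U, ∀ h, HasDirDerivAt f (df (x, h)) x h)
    (hc : ContinuousOn df (U ×ˢ univ)) {x : E} (hx : x ∈ U) (h k : E) :
    HasDirDerivAt f (df (x, h) + df (x, k)) x (h + k) := by
  -- The increment along t(h + k) is split at x + t h. The second piece has a moving base point,
  -- which is why joint convergence is needed.
  have h1 : Tendsto (fun t : ℝ => ((x + t • h, k), t)) (𝓝[≠] 0) (𝓝 (x, k) ×ˢ 𝓝[≠] 0) :=
    ((tendsto_add_smul x h).prodMk_nhds tendsto_const_nhds).prodMk tendsto_id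
  have h2 := (tendsto_differenceQuotient_of_continuousOn hU hd hc hx k).comp h1
  refine ((hd x hx h).add h2).congr fun t => ?_
  simp only [Function.comp_apply, ← smul_add, add_assoc]
  congr 1
  abel

theorem hasDirDerivAt_smul {E : Type*} [AddCommGroup E] [Module ℝ E] {f : E → F} {f' : F} {x h : E}
    (c : ℝ) (hd : HasDirDerivAt f f' x h) : HasDirDerivAt f (c • f') x (c • h) := by
  rcases eq_or_ne c 0 with rfl | hc
  · unfold HasDirDerivAt
    simpa using tendsto_const_nhds
  · have h1 : Tendsto (fun s : ℝ => s * c) (𝓝[≠] 0) (𝓝[≠] 0) := by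
      refine tendsto_nhdsWithin_of_tendsto_nhds_of_eventually_within _ ?_ ?_
      · have : Tendsto (fun s : ℝ => s * c) (𝓝 0) (𝓝 (0 * c)) :=
          (continuous_id.mul continuous_const).tendsto 0
        rw [zero_mul] at this
        exact this.mono_left nhdsWithin_le_nhds
      · filter_upwards [self_mem_nhdsWithin] with s hs
        exact mul_ne_zero hs hc
    refine ((hd.comp h1).const_smul c).congr fun t => ?_
    simp only [Function.comp_apply, smul_smul, mul_inv]
    congr 1
    field_simp

/-- The quotient of the composite is the quotient of g at f x in the moving direction given by the
quotient of f; joint convergence in the direction gives the limit. -/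
theorem HasDirDerivAt.comp_of_continuousOn {E : Type*} [AddCommGroup E] [Module ℝ E]
    {E' : Type*} [AddCommGroup E'] [Module ℝ E']
    [TopologicalSpace E'] [IsTopologicalAddGroup E'] [ContinuousSMul ℝ E'] {f : E → E'} {f' : E'}
    {x h : E} {g : E' → F} {dg : E' × E' → F} {V : Set E'} (hV : IsOpen V)
    (hd : ∀ x ∈ V, ∀ h, HasDirDerivAt g (dg (x, h)) x h)
    (hc : ContinuousOn dg (V ×ˢ univ)) (hx : f x ∈ V) (hf : HasDirDerivAt f f' x h) :
    HasDirDerivAt (g ∘ f) (dg (f x, f')) x h := by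
  have h1 : Tendsto (fun t : ℝ => ((f x, t⁻¹ • (f (x + t • h) - f x)), t)) (𝓝[≠] 0)
      (𝓝 (f x, f') ×ˢ 𝓝[≠] 0) :=
    (tendsto_const_nhds.prodMk_nhds hf).prodMk tendsto_id
  refine ((tendsto_differenceQuotient_of_continuousOn hV hd hc hx f').comp h1).congr' ?_
  filter_upwards [self_mem_nhdsWithin] with t ht
  simp only [Function.comp_apply, smul_smul, mul_inv_cancel₀ ht, one_smul, add_sub_cancel]

/-- The tangent map of a composite is the composite of tangent maps, each one order less
differentiable. The induction therefore has to vary both source spaces. -/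
theorem IsCk.comp {E' : Type v} [AddCommGroup E'] [Module ℝ E'] [TopologicalSpace E']
    [IsTopologicalAddGroup E'] [ContinuousSMul ℝ E'] {k : ℕ} {g : E' → F} {V : Set E'}
    (hV : IsOpen V) (hg : IsCk k g V) {E : Type u} [AddCommGroup E] [Module ℝ E]
    [TopologicalSpace E] {f : E → E'} {U : Set E}
    (hf : IsCk k f U) (hfU : MapsTo f U V) : IsCk k (g ∘ f) U := by
  induction k generalizing E E' with
  | zero => exact ContinuousOn.comp hg hf hfU
  | succ k ih =>
    obtain ⟨hfc, df, hfd, hdf⟩ := id hf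
    obtain ⟨hgc, dg, hgd, hdg⟩ := hg
    refine ⟨hgc.comp hfc hfU, fun q => dg (f q.1, df q), fun x hx h =>
      (hfd x hx h).comp_of_continuousOn hV hgd hdg.continuousOn (hfU hx), ?_⟩
    have h1 : IsCk k (f ∘ ContinuousLinearMap.fst ℝ E E) (U ×ˢ univ) :=
      (hf.of_succ.comp_clm (ContinuousLinearMap.fst ℝ E E)).mono fun q hq => hq.1
    exact ih (hV.prod isOpen_univ) hdg (h1.prodMk hdf) fun q hq => ⟨hfU hq.1, mem_univ _⟩

theorem IsCInf.comp {E' : Type v} [AddCommGroup E'] [Module ℝ E'] [TopologicalSpace E']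
    [IsTopologicalAddGroup E'] [ContinuousSMul ℝ E'] {g : E' → F} {V : Set E'}
    (hV : IsOpen V) (hg : IsCInf g V) {E : Type u} [AddCommGroup E] [Module ℝ E]
    [TopologicalSpace E] {f : E → E'} {U : Set E}
    (hf : IsCInf f U) (hfU : MapsTo f U V) : IsCInf (g ∘ f) U :=
  fun k => (hg k).comp hV (hf k) hfU

end ChainRule

section Normed

theorem ContDiffOn.isCInf {E : Type u} [NormedAddCommGroup E] [NormedSpace ℝ E]
    {F : Type w} [NormedAddCommGroup F] [NormedSpace ℝ F] {f : E → F} {U : Set E} (hU : IsOpen U)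
    (hf : ContDiffOn ℝ (⊤ : ℕ∞) f U) : IsCInf f U := by
  have key : ∀ (k : ℕ) {E : Type u} [NormedAddCommGroup E] [NormedSpace ℝ E] {f : E → F}
      {U : Set E} (_ : IsOpen U) (_ : ContDiffOn ℝ (⊤ : ℕ∞) f U), IsCk k f U := by
    intro k
    induction k with
    | zero => intro E _ _ f U _ hf; exact hf.continuousOn
    | succ k ih =>
      intro E _ _ f U hU hf
      refine ⟨hf.continuousOn, fun q => fderiv ℝ f q.1 q.2, fun x hx h => ?_,
        ih (hU.prod isOpen_univ) ?_⟩
      · have h1 : HasFDerivAt f (fderiv ℝ f x) x :=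
          ((hf.differentiableOn (by simp)).differentiableAt (hU.mem_nhds hx)).hasFDerivAt
        have h2 := (h1.hasLineDerivAt h).tendsto_slope_zero
        exact h2.congr fun t => by simp
      · have h1 : ContDiffOn ℝ (⊤ : ℕ∞) (fderiv ℝ f) U := hf.fderiv_of_isOpen hU (by simp)
        exact (h1.comp contDiffOn_fst fun q hq => hq.1).clm_apply contDiffOn_snd
  exact fun k => key k hU hf

end Normed

/-! ### Equivalence of the two notions of smoothness -/

section TaylorFamily

variable {E : Type u} [AddCommGroup E] [Module ℝ E]
  {F : Type w} [AddCommGroup F] [Module ℝ F] [TopologicalSpace F] [IsTopologicalAddGroup F]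
  [ContinuousSMul ℝ F]

/-- Expanding L(h + t w) over the sets of slots filled by w, the terms with at least two such slots
keep a positive power of t after division by t. The sum is finite and lives on one line, so
continuity of L plays no role. -/
theorem MultilinearMap.hasDirDerivAt {j : ℕ} (L : MultilinearMap ℝ (fun _ : Fin j => E) F)
    (h w : Fin j → E) :
    HasDirDerivAt L (∑ i, L (Function.update h i (w i))) h w := by
  classical
  have hs : ∀ s ∈ (Finset.univ : Finset (Finset (Fin j))).filter (2 ≤ Finset.card ·),
      Tendsto (fun t : ℝ => (t⁻¹ * t ^ s.card) • L (s.piecewise w h)) (𝓝[≠] 0) (𝓝 0) := by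
    intro s hs
    obtain ⟨m, hm⟩ := Nat.exists_eq_add_of_le (Finset.mem_filter.1 hs).2
    have h1 : Tendsto (fun t : ℝ => t ^ (m + 1) • L (s.piecewise w h)) (𝓝[≠] 0) (𝓝 0) := by
      have h2 : Continuous fun t : ℝ => t ^ (m + 1) • L (s.piecewise w h) := by fun_prop
      have h3 := h2.tendsto 0
      rw [zero_pow (Nat.succ_ne_zero m), zero_smul] at h3
      exact h3.mono_left nhdsWithin_le_nhds
    refine h1.congr' ?_
    filter_upwards [self_mem_nhdsWithin] with t ht
    congr 1
    rw [hm]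
    have ht' : t ≠ 0 := ht
    field_simp
    ring
  have h0 : Tendsto (fun t : ℝ => ∑ i, L (Function.update h i (w i)) +
      ∑ s with 2 ≤ Finset.card s, (t⁻¹ * t ^ s.card) • L (s.piecewise w h)) (𝓝[≠] 0)
      (𝓝 (∑ i, L (Function.update h i (w i)))) := by
    simpa using (tendsto_const_nhds (x := ∑ i, L (Function.update h i (w i)))).add
      (tendsto_finsetSum _ hs)
  refine h0.congr' ?_
  filter_upwards [self_mem_nhdsWithin] with t ht
  have hpw : ∀ s : Finset (Fin j), L (s.piecewise (t • w) h) = t ^ s.card • L (s.piecewise w h) := by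
    intro s
    have := L.map_piecewise_smul (fun _ => t) (s.piecewise w h) s
    rw [Finset.prod_const] at this
    rw [← this]
    congr 1
    ext i
    by_cases hi : i ∈ s <;> simp [hi]
  rw [L.map_add_eq_map_add_linearDeriv_add, map_smul, MultilinearMap.linearDeriv_apply, add_assoc,
    add_sub_cancel_left, smul_add, smul_smul, inv_mul_cancel₀ ht, one_smul, Finset.smul_sum]
  simp only [hpw, smul_smul]

variable [TopologicalSpace E]

/-- The continuous linear map `((x, h), (v, w)) ↦ (x, (h, v))`. -/
def snocBaseCLM (E : Type u) [AddCommGroup E] [Module ℝ E] [TopologicalSpace E] (j : ℕ) :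
    ((E × (Fin j → E)) × (E × (Fin j → E))) →L[ℝ] E × (Fin (j + 1) → E) where
  toFun q := (q.1.1, Fin.snoc (α := fun _ => E) q.1.2 q.2.1)
  map_add' p q := by
    refine Prod.ext rfl (funext fun i => ?_)
    cases i using Fin.lastCases <;> simp
  map_smul' c q := by
    refine Prod.ext rfl (funext fun i => ?_)
    cases i using Fin.lastCases <;> simp
  cont := by
    refine Continuous.prodMk (by fun_prop) (Continuous.finSnoc (A := fun _ => E) ?_ ?_) <;> fun_prop

/-- The continuous linear map `((x, h), (v, w)) ↦ (x, h')`, where `h'` arises from `h` by replacing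
the `i`-th entry by `w i`. -/
def updateCLM (E : Type u) [AddCommGroup E] [Module ℝ E] [TopologicalSpace E] (j : ℕ) (i : Fin j) :
    ((E × (Fin j → E)) × (E × (Fin j → E))) →L[ℝ] E × (Fin j → E) where
  toFun q := (q.1.1, Function.update q.1.2 i (q.2.2 i))
  map_add' p q := by
    refine Prod.ext rfl (funext fun m => ?_)
    rcases eq_or_ne m i with rfl | hm <;> simp [*]
  map_smul' c q := by
    refine Prod.ext rfl (funext fun m => ?_)
    rcases eq_or_ne m i with rfl | hm <;> simp [*]
  cont := by fun_prop

variable [IsTopologicalAddGroup E] [ContinuousSMul ℝ E] [LocallyConvexSpace ℝ F]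

/-- The higher directional derivatives of a smooth map are multilinear. -/
theorem exists_multilinearMap_of_hasDirDerivAt [T2Space F] {U : Set E} (hU : IsOpen U)
    {D : (j : ℕ) → E → (Fin j → E) → F}
    (hd : ∀ j, ∀ x ∈ U, ∀ (h : Fin j → E) (v : E),
      HasDirDerivAt (fun y => D j y h) (D (j + 1) x (Fin.snoc (α := fun _ => E) h v)) x v)
    (hc : ∀ j, ContinuousOn (fun q : E × (Fin j → E) => D j q.1 q.2) (U ×ˢ univ)) (j : ℕ) :
    ∀ x ∈ U, ∃ L : MultilinearMap ℝ (fun _ : Fin j => E) F, ⇑L = D j x := by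
  induction j with
  | zero =>
    intro x _
    refine ⟨MultilinearMap.constOfIsEmpty ℝ _ (D 0 x default), funext fun h => ?_⟩
    rw [MultilinearMap.constOfIsEmpty_apply, Subsingleton.elim h default]
    rfl
  | succ j ih =>
    intro x hx
    have hsnoc : ∀ h : Fin (j + 1) → E,
        h = Fin.snoc (α := fun _ => E) (Fin.init h) (h (Fin.last j)) :=
      fun h => (Fin.snoc_init_self h).symm
    have hcont : ∀ h : Fin j → E, ContinuousOn
        (fun q : E × E => D (j + 1) q.1 (Fin.snoc (α := fun _ => E) h q.2)) (U ×ˢ univ) := by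
      intro h
      have h1 : Continuous fun q : E × E => (q.1, Fin.snoc (α := fun _ => E) h q.2) :=
        Continuous.prodMk continuous_fst
          (Continuous.finSnoc (A := fun _ => E) continuous_const continuous_snd)
      exact (hc (j + 1)).comp h1.continuousOn fun q hq => ⟨hq.1, mem_univ _⟩
    -- Linearity in the newest slot is linearity of a continuous directional derivative.
    have hlast_add : ∀ (h : Fin j → E) (v w : E),
        D (j + 1) x (Fin.snoc (α := fun _ => E) h (v + w)) =
        D (j + 1) x (Fin.snoc (α := fun _ => E) h v) +
          D (j + 1) x (Fin.snoc (α := fun _ => E) h w) := fun h v w =>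
      (hd j x hx h (v + w)).unique (hasDirDerivAt_add hU (fun y hy k => hd j y hy h k)
        (df := fun q : E × E => D (j + 1) q.1 (Fin.snoc (α := fun _ => E) h q.2)) (hcont h) hx v w)
    have hlast_smul : ∀ (h : Fin j → E) (c : ℝ) (v : E),
        D (j + 1) x (Fin.snoc (α := fun _ => E) h (c • v)) =
        c • D (j + 1) x (Fin.snoc (α := fun _ => E) h v) := fun h c v =>
      (hd j x hx h (c • v)).unique (hasDirDerivAt_smul c (hd j x hx h v))
    have hnear : ∀ v : E, ∀ᶠ t : ℝ in 𝓝[≠] 0, x + t • v ∈ U := fun v =>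
      (tendsto_add_smul x v).eventually (hU.eventually_mem hx)
    -- In the older slots, linearity passes to the limit from difference quotients of the map of
    -- order j, which is multilinear at x and at x + t v by induction.
    have hinit_add : ∀ (h : Fin j → E) (i : Fin j) (a b v : E),
        D (j + 1) x (Fin.snoc (α := fun _ => E) (Function.update h i (a + b)) v) =
        D (j + 1) x (Fin.snoc (α := fun _ => E) (Function.update h i a) v) +
        D (j + 1) x (Fin.snoc (α := fun _ => E) (Function.update h i b) v) := by
      intro h i a b v
      refine tendsto_nhds_unique_of_eventuallyEq (hd j x hx _ v)
        ((hd j x hx _ v).add (hd j x hx _ v)) ?_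
      filter_upwards [hnear v] with t ht
      obtain ⟨L, hL⟩ := ih x hx
      obtain ⟨L', hL'⟩ := ih _ ht
      simp only [← hL, ← hL', MultilinearMap.map_update_add, ← smul_add, add_sub_add_comm]
    have hinit_smul : ∀ (h : Fin j → E) (i : Fin j) (c : ℝ) (a v : E),
        D (j + 1) x (Fin.snoc (α := fun _ => E) (Function.update h i (c • a)) v) =
        c • D (j + 1) x (Fin.snoc (α := fun _ => E) (Function.update h i a) v) := by
      intro h i c a v
      refine tendsto_nhds_unique_of_eventuallyEq (hd j x hx _ v)
        ((hd j x hx _ v).const_smul c) ?_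
      filter_upwards [hnear v] with t ht
      obtain ⟨L, hL⟩ := ih x hx
      obtain ⟨L', hL'⟩ := ih _ ht
      simp only [← hL, ← hL', MultilinearMap.map_update_smul, ← smul_sub, smul_comm c]
    refine ⟨MultilinearMap.mk' (D (j + 1) x) ?_ ?_, rfl⟩
    · intro m i a b
      rw [hsnoc m]
      cases i using Fin.lastCases with
      | last => simp only [Fin.update_snoc_last, hlast_add]
      | cast i => simp only [← Fin.snoc_update, hinit_add]
    · intro m i c a
      rw [hsnoc m]
      cases i using Fin.lastCases with
      | last => simp only [Fin.update_snoc_last, hlast_smul]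
      | cast i => simp only [← Fin.snoc_update, hinit_smul]

/-- All the maps (x, h) ↦ D j x h are treated together: the tangent map of the one of order j is
built from those of orders j + 1 and j by linear substitutions, so induction on k works for all j at
once. -/
theorem IsSmoothOn.isCInf [T2Space F] {f : E → F} {U : Set E} (hU : IsOpen U)
    (hf : IsSmoothOn f U) : IsCInf f U := by
  obtain ⟨D, h0, hd, hc⟩ := hf
  have key : ∀ k j, IsCk k (fun q : E × (Fin j → E) => D j q.1 q.2) (U ×ˢ univ) := by
    intro k
    induction k with
    | zero => exact hc
    | succ k ih =>
      intro j
      refine ⟨hc j, fun q => D (j + 1) (snocBaseCLM E j q).1 (snocBaseCLM E j q).2 +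
        ∑ i, D j (updateCLM E j i q).1 (updateCLM E j i q).2, ?_, ?_⟩
      · rintro ⟨x, h⟩ ⟨hx, -⟩ ⟨v, w⟩
        obtain ⟨L, hL⟩ := exists_multilinearMap_of_hasDirDerivAt hU hd hc j x hx
        have h1 := L.hasDirDerivAt h w
        rw [hL] at h1
        have hcont : ContinuousAt (fun q : (Fin j → E) × E × E =>
            D (j + 1) q.2.1 (Fin.snoc (α := fun _ => E) q.1 q.2.2)) (h, x, v) := by
          have h2 : Continuous fun q : (Fin j → E) × E × E =>
              (q.2.1, Fin.snoc (α := fun _ => E) q.1 q.2.2) :=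
            Continuous.prodMk (by fun_prop)
              (Continuous.finSnoc (A := fun _ => E) (by fun_prop) (by fun_prop))
          exact ContinuousAt.comp (f := fun q : (Fin j → E) × E × E =>
              (q.2.1, Fin.snoc (α := fun _ => E) q.1 q.2.2))
            ((hc (j + 1)).continuousAt ((hU.prod isOpen_univ).mem_nhds ⟨hx, mem_univ _⟩))
            h2.continuousAt
        have hev : ∀ᶠ q : (Fin j → E) × E × E in 𝓝 h ×ˢ 𝓝 (x, v), q.2.1 ∈ U := by
          rw [← nhds_prod_eq]
          exact ((continuous_fst.comp continuous_snd).tendsto (h, x, v)).eventually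
            (hU.eventually_mem hx)
        -- The increment in (v, w) is split into one in x, with the slots at h + t w as a moving
        -- parameter, and one in the slots at fixed x, which is the multilinear case `h1`.
        have h3 := tendsto_differenceQuotient (P := Fin j → E) (l := 𝓝 h)
          (f := fun p y => D j y p)
          (df := fun p y k => D (j + 1) y (Fin.snoc (α := fun _ => E) p k))
          (x₀ := x) (h₀ := v) (L := D (j + 1) x (Fin.snoc (α := fun _ => E) h v))
          (hev.mono fun q hq => hd j q.2.1 hq q.1 q.2.2)
          (by rw [← nhds_prod_eq]; exact hcont)
        have h4 : Tendsto (fun t : ℝ => ((h + t • w, x, v), t)) (𝓝[≠] 0)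
            ((𝓝 h ×ˢ 𝓝 (x, v)) ×ˢ 𝓝[≠] 0) :=
          ((tendsto_add_smul h w).prodMk tendsto_const_nhds).prodMk tendsto_id
        refine ((h3.comp h4).add h1).congr fun t => ?_
        simp only [Function.comp_apply, ← smul_add, Prod.mk_add_mk, Prod.smul_mk,
          sub_add_sub_cancel]
      · refine IsCk.add ((ih (j + 1)).comp_clm (snocBaseCLM E j) |>.mono ?_)
          (IsCk.sum _ fun i _ => (ih j).comp_clm (updateCLM E j i) |>.mono ?_)
        · exact fun q hq => ⟨hq.1.1, mem_univ _⟩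
        · exact fun q hq => ⟨hq.1.1, mem_univ _⟩
  intro k
  have h1 := (key k 0).comp_clm ((ContinuousLinearMap.id ℝ E).prod (0 : E →L[ℝ] (Fin 0 → E)))
  refine (h1.mono fun x hx => ⟨hx, mem_univ _⟩).congr hU fun x hx => h0 x hx _

/-- The family is built by recursion, each member being the derivative of the previous one with the
slots held fixed. The recursion runs over maps bundled with their smoothness, so that a next
derivative always exists. -/
theorem IsCInf.isSmoothOn [T2Space F] {f : E → F} {U : Set E} (hU : IsOpen U)
    (hf : IsCInf f U) : IsSmoothOn f U := by
  have step : ∀ (j : ℕ) (D : {D : E × (Fin j → E) → F // IsCInf D (U ×ˢ univ)}),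
      ∃ D' : {D : E × (Fin (j + 1) → E) → F // IsCInf D (U ×ˢ univ)},
        ∀ x ∈ U, ∀ (h : Fin j → E) (v : E), HasDirDerivAt (fun y => D.1 (y, h))
          (D'.1 (x, Fin.snoc (α := fun _ => E) h v)) x v := by
    rintro j ⟨D, hD⟩
    obtain ⟨dD, hd, hdD⟩ := hD.exists_deriv (hU.prod isOpen_univ)
    -- The last slot becomes the direction in E, and the direction in the remaining slots is 0.
    let L : E × (Fin (j + 1) → E) →L[ℝ] (E × (Fin j → E)) × (E × (Fin j → E)) :=
      ((ContinuousLinearMap.fst ℝ _ _).prod ((ContinuousLinearMap.pi fun i =>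
        ContinuousLinearMap.proj i.castSucc).comp (ContinuousLinearMap.snd ℝ _ _))).prod
      (((ContinuousLinearMap.proj (Fin.last j)).comp (ContinuousLinearMap.snd ℝ _ _)).prod 0)
    refine ⟨⟨dD ∘ L, (hdD.comp_clm L).mono fun q hq => ⟨⟨hq.1, mem_univ _⟩, mem_univ _⟩⟩, ?_⟩
    intro x hx h v
    have hL : L (x, Fin.snoc (α := fun _ => E) h v) = ((x, h), (v, 0)) := by
      simp [L]
    simp only [Function.comp_apply, hL]
    refine Tendsto.congr (fun t => ?_) (hd (x, h) ⟨hx, mem_univ _⟩ (v, 0))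
    simp
  choose next hnext using step
  let D : (j : ℕ) → {D : E × (Fin j → E) → F // IsCInf D (U ×ˢ univ)} := fun j =>
    Nat.rec ⟨f ∘ ContinuousLinearMap.fst ℝ E (Fin 0 → E),
      (hf.comp_clm (ContinuousLinearMap.fst ℝ E (Fin 0 → E))).mono fun q hq => hq.1⟩
      (fun j D => next j D) j
  exact ⟨fun j x h => (D j).1 (x, h), fun x _ h => rfl, fun j => hnext j (D j),
    fun j => (D j).2.continuousOn⟩

theorem isSmoothOn_iff_isCInf [T2Space F] {f : E → F} {U : Set E} (hU : IsOpen U) :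
    IsSmoothOn f U ↔ IsCInf f U :=
  ⟨fun h => h.isCInf hU, fun h => h.isSmoothOn hU⟩

end TaylorFamily

/-! ### Smoothness of Hilbert space valued maps from their Gram kernels -/

section Kernel

variable {H : Type w} [NormedAddCommGroup H] [InnerProductSpace ℂ H]

theorem norm_sub_sq_eq_re_inner (a b : H) :
    ‖a - b‖ ^ 2 = (inner ℂ a a - inner ℂ a b - inner ℂ b a + inner ℂ b b : ℂ).re := by
  rw [← inner_self_eq_norm_sq (𝕜 := ℂ) (a - b), inner_sub_left, inner_sub_right, inner_sub_right]
  simp only [RCLike.re_to_complex, Complex.sub_re, Complex.add_re]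
  ring

/-- A family whose Gram kernel converges is itself convergent. -/
theorem exists_tendsto_of_tendsto_inner [CompleteSpace H] {T : Type*} {l : Filter T} [l.NeBot]
    {f : T → H} {L : ℂ}
    (h : Tendsto (fun p : T × T => inner ℂ (f p.1) (f p.2)) (l ×ˢ l) (𝓝 L)) :
    ∃ a, Tendsto f l (𝓝 a) := by
  refine cauchy_map_iff_exists_tendsto.1 (cauchy_map_iff.2 ⟨inferInstance, ?_⟩)
  rw [tendsto_uniformity_iff_dist_tendsto_zero]
  -- The squared distance is a combination of four kernel values with signs +, −, −, +, all with the
  -- same limit, so the family is Cauchy.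
  have h11 := h.comp ((tendsto_fst (f := l) (g := l)).prodMk tendsto_fst)
  have h22 := h.comp ((tendsto_snd (f := l) (g := l)).prodMk tendsto_snd)
  have h21 := h.comp ((tendsto_snd (f := l) (g := l)).prodMk tendsto_fst)
  have h1 := (Complex.continuous_re.tendsto _).comp (((h11.sub h).sub h21).add h22)
  have h2 := (Real.continuous_sqrt.tendsto _).comp h1
  simp only [sub_self, zero_sub, neg_add_cancel, Complex.zero_re, Real.sqrt_zero] at h2
  refine h2.congr fun p => ?_
  simp only [Function.comp_apply]
  rw [← norm_sub_sq_eq_re_inner, Real.sqrt_sq (norm_nonneg _), dist_eq_norm]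

/-- The squared distance ‖f y − f x‖² is a combination of four kernel values that cancel in the
limit; continuity of the kernel at the diagonal point (x, x) is all that enters. -/
theorem continuousOn_of_continuousOn_inner {X : Type*} [TopologicalSpace X] {f : X → H} {U : Set X}
    (h : ContinuousOn (fun q : X × X => inner ℂ (f q.1) (f q.2)) (U ×ˢ U)) : ContinuousOn f U := by
  intro x hx
  have hid : Tendsto (fun y => y) (𝓝[U] x) (𝓝[U] x) := tendsto_id
  have hco : Tendsto (fun _ : X => x) (𝓝[U] x) (𝓝[U] x) :=
    tendsto_const_pure.mono_right (pure_le_nhdsWithin hx)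
  have h0 := h (x, x) ⟨hx, hx⟩
  rw [ContinuousWithinAt, nhdsWithin_prod_eq] at h0
  have h1 := (Complex.continuous_re.tendsto _).comp ((((h0.comp (hid.prodMk hid)).sub
    (h0.comp (hid.prodMk hco))).sub (h0.comp (hco.prodMk hid))).add (h0.comp (hco.prodMk hco)))
  have h2 := (Real.continuous_sqrt.tendsto _).comp h1
  simp only [sub_self, zero_sub, neg_add_cancel, Complex.zero_re, Real.sqrt_zero] at h2
  rw [ContinuousWithinAt, tendsto_iff_norm_sub_tendsto_zero]
  refine h2.congr fun p => ?_
  simp only [Function.comp_apply]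
  rw [← norm_sub_sq_eq_re_inner, Real.sqrt_sq (norm_nonneg _)]

section Derivative

variable {E : Type u} [AddCommGroup E] [Module ℝ E] [TopologicalSpace E] [IsTopologicalAddGroup E]
  [ContinuousSMul ℝ E]

/-- The inner product of the difference quotients with increments t and s is a mixed second
difference quotient of the kernel at (x, x). It converges to the mixed second derivative as t and s
tend to 0 independently, so the quotients converge by completeness. -/
theorem hasDirDerivAt_of_kernel [CompleteSpace H] {v : E → H} {U : Set E} (hU : IsOpen U)
    {dK : (E × E) × (E × E) → ℂ} {ddK : ((E × E) × (E × E)) × ((E × E) × (E × E)) → ℂ}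
    (hd : ∀ q ∈ U ×ˢ U, ∀ h,
      HasDirDerivAt (fun q : E × E => inner ℂ (v q.1) (v q.2)) (dK (q, h)) q h)
    (hdd : ∀ q ∈ (U ×ˢ U) ×ˢ univ, ∀ h, HasDirDerivAt dK (ddK (q, h)) q h)
    (hddc : ContinuousOn ddK (((U ×ˢ U) ×ˢ univ) ×ˢ univ)) {x : E} (hx : x ∈ U) (h : E) :
    ∃ a, HasDirDerivAt v a x h := by
  refine exists_tendsto_of_tendsto_inner
    (L := ddK (((x, x), (h, 0)), ((0, h), (0, 0)))) (l := 𝓝[≠] (0 : ℝ)) ?_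
  -- First limit: the quotient in the second variable, applied to the derivative in the first, with
  -- base point and direction of the latter still moving.
  have hop : IsOpen ((U ×ˢ U) ×ˢ (univ : Set (E × E))) := (hU.prod hU).prod isOpen_univ
  have h1 := tendsto_differenceQuotient_of_continuousOn hop hdd hddc
    (x := ((x, x), (h, 0))) ⟨⟨hx, hx⟩, mem_univ _⟩ ((0, h), (0, 0))
  have hm : Tendsto (fun p : ℝ × E × E =>
      ((((p.2.1, x), (p.2.2, (0 : E))), (((0 : E), h), ((0 : E), (0 : E)))), p.1))
      (𝓝[≠] 0 ×ˢ 𝓝 (x, h)) (𝓝 (((x, x), (h, 0)), ((0, h), (0, 0))) ×ˢ 𝓝[≠] 0) := by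
    refine Tendsto.prodMk ?_ tendsto_fst
    have hcont : Continuous fun p : E × E =>
        ((((p.1, x), (p.2, (0 : E))), (((0 : E), h), ((0 : E), (0 : E))))) := by fun_prop
    exact (hcont.tendsto (x, h)).comp tendsto_snd
  have h2 := h1.comp hm
  have hev : ∀ᶠ p : ℝ × E × E in 𝓝[≠] 0 ×ˢ 𝓝 (x, h), x + p.1 • h ∈ U ∧ p.2.1 ∈ U :=
    ((tendsto_add_smul x h).eventually (hU.eventually_mem hx)).prod_mk
      ((continuous_fst.tendsto (x, h)).eventually (hU.eventually_mem hx))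
  -- Second limit: the quotient in the first variable, with the increment s of the second variable
  -- as parameter. This yields the joint limit rather than an iterated one.
  have h3 := tendsto_differenceQuotient (P := ℝ) (l := 𝓝[≠] 0)
    (f := fun s y => s⁻¹ • (inner ℂ (v y) (v (x + s • h)) - inner ℂ (v y) (v x)))
    (df := fun s y k => s⁻¹ • (dK ((y, x + s • h), (k, 0)) - dK ((y, x), (k, 0))))
    (x₀ := x) (h₀ := h) (L := ddK (((x, x), (h, 0)), ((0, h), (0, 0))))
    (by
      filter_upwards [hev] with p hp
      have ha := hd (p.2.1, x + p.1 • h) ⟨hp.2, hp.1⟩ (p.2.2, 0)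
      have hb := hd (p.2.1, x) ⟨hp.2, hx⟩ (p.2.2, 0)
      refine ((Tendsto.sub ha hb).const_smul p.1⁻¹).congr fun t => ?_
      simp only [Prod.smul_mk, Prod.mk_add_mk, smul_zero, add_zero, ← smul_sub]
      rw [smul_comm, sub_sub_sub_comm])
    (by
      refine h2.congr fun p => ?_
      simp)
  have hm' : Tendsto (fun p : ℝ × ℝ => ((p.2, x, h), p.1)) (𝓝[≠] 0 ×ˢ 𝓝[≠] 0)
      ((𝓝[≠] 0 ×ˢ 𝓝 (x, h)) ×ˢ 𝓝[≠] 0) :=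
    (tendsto_snd.prodMk tendsto_const_nhds).prodMk tendsto_fst
  refine (h3.comp hm').congr fun p => ?_
  simp only [Function.comp_apply, inner_smul_left_eq_smul, inner_smul_right_eq_smul,
    inner_sub_left, inner_sub_right, ← smul_sub]
  rw [smul_comm, sub_sub_sub_comm]

end Derivative

/-- A map into a Hilbert space with a smooth Gram kernel is smooth. -/
theorem IsCk.of_kernel [CompleteSpace H] {k : ℕ} : ∀ {E : Type u} [AddCommGroup E] [Module ℝ E]
    [TopologicalSpace E] [IsTopologicalAddGroup E] [ContinuousSMul ℝ E] {v : E → H} {U : Set E}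
    (_ : IsOpen U) (_ : IsCInf (fun q : E × E => inner ℂ (v q.1) (v q.2)) (U ×ˢ U)),
    IsCk k v U := by
  induction k with
  | zero =>
    intro E _ _ _ _ _ v U _ hK
    exact continuousOn_of_continuousOn_inner hK.continuousOn
  | succ k ih =>
    intro E _ _ _ _ _ v U hU hK
    refine ⟨continuousOn_of_continuousOn_inner hK.continuousOn, ?_⟩
    obtain ⟨dK, hd, hdK⟩ := hK.exists_deriv (hU.prod hU)
    obtain ⟨ddK, hdd, hddK⟩ := hdK.exists_deriv ((hU.prod hU).prod isOpen_univ)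
    have hex : ∀ q : E × E, ∃ a, q.1 ∈ U → HasDirDerivAt v a q.1 q.2 := by
      intro q
      by_cases hq : q.1 ∈ U
      · obtain ⟨a, ha⟩ := hasDirDerivAt_of_kernel hU hd hdd hddK.continuousOn hq q.2
        exact ⟨a, fun _ => ha⟩
      · exact ⟨0, fun h => absurd h hq⟩
    choose dv hdv using hex
    have hright : ∀ x ∈ U, ∀ q : E × E, q.1 ∈ U →
        inner ℂ (v x) (dv q) = dK ((x, q.1), (0, q.2)) := by
      intro x hx q hq
      refine tendsto_nhds_unique (tendsto_const_nhds.inner (hdv q hq)) ?_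
      refine Tendsto.congr (fun t => ?_) (hd (x, q.1) ⟨hx, hq⟩ (0, q.2))
      simp [inner_smul_right_eq_smul, inner_sub_right]
    -- The Gram kernel of the derivative is a second derivative of the kernel after a linear
    -- substitution, hence smooth, so the induction hypothesis applies to the derivative.
    have hboth : ∀ p q : E × E, p.1 ∈ U → q.1 ∈ U → inner ℂ (dv p) (dv q) =
        ddK (((p.1, q.1), (0, q.2)), ((p.2, 0), (0, 0))) := by
      intro p q hp hq
      refine tendsto_nhds_unique ((hdv p hp).inner tendsto_const_nhds) ?_
      refine Tendsto.congr' ?_ (hdd ((p.1, q.1), (0, q.2)) ⟨⟨hp, hq⟩, mem_univ _⟩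
        ((p.2, 0), (0, 0)))
      filter_upwards [(tendsto_add_smul p.1 p.2).eventually (hU.eventually_mem hp)] with t ht
      simp [inner_smul_left_eq_smul, inner_sub_left, hright _ hp q hq, hright _ ht q hq]
    refine ⟨dv, fun x hx h => hdv (x, h) hx, ih (hU.prod isOpen_univ) ?_⟩
    let fs := ContinuousLinearMap.fst ℝ (E × E) (E × E)
    let sn := ContinuousLinearMap.snd ℝ (E × E) (E × E)
    let a := ContinuousLinearMap.fst ℝ E E
    let b := ContinuousLinearMap.snd ℝ E E
    let L : (E × E) × (E × E) →L[ℝ] ((E × E) × (E × E)) × ((E × E) × (E × E)) :=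
      (((a.comp fs).prod (a.comp sn)).prod ((0 : _ →L[ℝ] E).prod (b.comp sn))).prod
        (((b.comp fs).prod 0).prod (0 : _ →L[ℝ] E × E))
    refine ((hddK.comp_clm L).mono ?_).congr
      ((hU.prod isOpen_univ).prod (hU.prod isOpen_univ)) ?_
    · exact fun q hq => ⟨⟨⟨hq.1.1, hq.2.1⟩, mem_univ _⟩, mem_univ _⟩
    · exact fun q hq => (hboth q.1 q.2 hq.1.1 hq.2.1).symm

theorem IsCInf.of_kernel [CompleteSpace H] {E : Type u} [AddCommGroup E] [Module ℝ E]
    [TopologicalSpace E] [IsTopologicalAddGroup E] [ContinuousSMul ℝ E] {v : E → H} {U : Set E}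
    (hU : IsOpen U) (hK : IsCInf (fun q : E × E => inner ℂ (v q.1) (v q.2)) (U ×ˢ U)) :
    IsCInf v U :=
  fun _ => IsCk.of_kernel hU hK

end Kernel

/-! ### Vector-valued smooth maps on manifolds -/

/-- Smoothness on an open set `U` of a vector-valued map on a manifold with atlas `A`: all local
representatives are smooth. -/
def IsSmoothVec {E : Type u} {F : Type w} {M : Type*} [AddCommGroup E] [Module ℝ E]
    [TopologicalSpace E] [AddCommGroup F] [Module ℝ F] [TopologicalSpace F] [TopologicalSpace M]
    (A : Set (OpenPartialHomeomorph M E)) (f : M → F) (U : Set M) : Prop :=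
  ∀ a ∈ A, IsCInf (f ∘ a.symm) (a.target ∩ a.symm ⁻¹' U)

section Manifold

variable {E : Type u} [AddCommGroup E] [Module ℝ E] [TopologicalSpace E] [IsTopologicalAddGroup E]
  [ContinuousSMul ℝ E] {M : Type*} [TopologicalSpace M] {A : Set (OpenPartialHomeomorph M E)}
  {F : Type w} [AddCommGroup F] [Module ℝ F] [TopologicalSpace F]

namespace IsSmoothVec

variable {f g : M → F} {U V : Set M}

theorem mono (hf : IsSmoothVec A f U) (hV : V ⊆ U) : IsSmoothVec A f V :=
  fun a ha => (hf a ha).mono (inter_subset_inter_right _ (preimage_mono hV))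

theorem congr (hf : IsSmoothVec A f U) (hU : IsOpen U) (hfg : EqOn f g U) : IsSmoothVec A g U :=
  fun a ha => (hf a ha).congr (a.symm.isOpen_inter_preimage hU) fun _ hx => hfg hx.2

theorem prodMk {F' : Type v} [AddCommGroup F'] [Module ℝ F'] [TopologicalSpace F'] {f' : M → F'}
    (hf : IsSmoothVec A f U) (hf' : IsSmoothVec A f' U) :
    IsSmoothVec A (fun x => (f x, f' x)) U :=
  fun a ha => (hf a ha).prodMk (hf' a ha)

theorem of_local [T2Space F] (hU : IsOpen U)
    (h : ∀ x ∈ U, ∃ V, IsOpen V ∧ x ∈ V ∧ IsSmoothVec A f V) : IsSmoothVec A f U := by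
  refine fun a ha => IsCInf.of_local (a.symm.isOpen_inter_preimage hU) fun x hx => ?_
  obtain ⟨V, hV, hxV, hf⟩ := h _ hx.2
  exact ⟨_, a.symm.isOpen_inter_preimage hV, ⟨hx.1, hxV⟩, hf a ha⟩

theorem continuousOn (hA : ∀ x, ∃ a ∈ A, x ∈ a.source) (hU : IsOpen U)
    (hf : IsSmoothVec A f U) : ContinuousOn f U := by
  intro x hx
  obtain ⟨a, ha, hxa⟩ := hA x
  have h1 : ContinuousAt (f ∘ a.symm) (a x) :=
    (hf a ha).continuousOn.continuousAt ((a.symm.isOpen_inter_preimage hU).mem_nhds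
      ⟨a.map_source hxa, by simpa [a.left_inv hxa] using hx⟩)
  have h2 : ContinuousAt ((f ∘ a.symm) ∘ a) x := h1.comp (a.continuousAt hxa)
  refine (h2.congr ?_).continuousWithinAt
  filter_upwards [a.open_source.mem_nhds hxa] with y hy
  simp [a.left_inv hy]

theorem comp_isCInf {F' : Type v} [AddCommGroup F'] [Module ℝ F'] [TopologicalSpace F']
    [IsTopologicalAddGroup F'] [ContinuousSMul ℝ F'] [LocallyConvexSpace ℝ F']
    [IsTopologicalAddGroup F] [ContinuousSMul ℝ F] {φ : F → F'} {W : Set F} (hW : IsOpen W)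
    (hφ : IsCInf φ W) (hf : IsSmoothVec A f U) (hfU : MapsTo f U W) :
    IsSmoothVec A (fun x => φ (f x)) U :=
  fun a ha => hφ.comp hW (hf a ha) fun _ hx => hfU hx.2

/-- Pullback along a smooth map of manifolds. -/
theorem comp_isSmoothMapOn [IsTopologicalAddGroup F] [ContinuousSMul ℝ F] [LocallyConvexSpace ℝ F]
    [T2Space F] {E' : Type v} [AddCommGroup E'] [Module ℝ E'] [TopologicalSpace E']
    [IsTopologicalAddGroup E'] [ContinuousSMul ℝ E'] [LocallyConvexSpace ℝ E'] [T2Space E']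
    {N : Type*} [TopologicalSpace N] {B : Set (OpenPartialHomeomorph N E')}
    (hB : ∀ y, ∃ b ∈ B, y ∈ b.source) {m : M → N} (hm : IsSmoothMapOn A B m univ) {f : N → F}
    {W : Set N} (hW : IsOpen W) (hf : IsSmoothVec B f W) :
    IsSmoothVec A (fun x => f (m x)) (m ⁻¹' W) := by
  have hmc : Continuous m := continuousOn_univ.1 hm.1
  refine fun a ha => IsCInf.of_local (a.symm.isOpen_inter_preimage (hW.preimage hmc)) fun x hx => ?_
  obtain ⟨b, hb, hxb⟩ := hB (m (a.symm x))
  have hop : IsOpen (a.target ∩ a.symm ⁻¹' (univ ∩ m ⁻¹' b.source)) :=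
    a.symm.isOpen_inter_preimage (isOpen_univ.inter (b.open_source.preimage hmc))
  have h1 := (hm.2 a ha b hb).isCInf hop
  have hop' := hop.inter (a.symm.isOpen_inter_preimage (hW.preimage hmc))
  refine ⟨_, hop', ⟨⟨hx.1, mem_univ _, hxb⟩, hx⟩, ?_⟩
  refine ((hf b hb).comp (b.symm.isOpen_inter_preimage hW) (h1.mono inter_subset_left) ?_).congr
    hop' ?_
  · intro y hy
    refine ⟨b.map_source hy.1.2.2, ?_⟩
    have h2 : b.symm (b (m (a.symm y))) = m (a.symm y) := b.left_inv hy.1.2.2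
    change b.symm (b (m (a.symm y))) ∈ W
    rw [h2]
    exact hy.2.2
  · intro y hy
    have h2 : b.symm (b (m (a.symm y))) = m (a.symm y) := b.left_inv hy.1.2.2
    simp only [Function.comp_apply, h2]

/-- This serves to substitute g⁻¹ in the first variable. The second variable keeps its own chart, so
no transition maps are needed. -/
theorem comp_prodMap_id [IsTopologicalAddGroup F] [ContinuousSMul ℝ F] [LocallyConvexSpace ℝ F]
    [T2Space F] [LocallyConvexSpace ℝ E] [T2Space E] (hA : ∀ y, ∃ b ∈ A, y ∈ b.source) {m : M → M}
    (hm : IsSmoothMapOn A A m univ) {f : M × M → F} {W : Set (M × M)} (hW : IsOpen W)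
    (hf : IsSmoothVec (prodAtlas A) f W) :
    IsSmoothVec (prodAtlas A) (fun q : M × M => f (m q.1, q.2))
      ((fun q : M × M => (m q.1, q.2)) ⁻¹' W) := by
  have hmc : Continuous m := continuousOn_univ.1 hm.1
  have hWop : IsOpen ((fun q : M × M => (m q.1, q.2)) ⁻¹' W) := hW.preimage (by fun_prop)
  rintro _ ⟨a, ha, a', ha', rfl⟩
  have hop0 := (a.prod a').symm.isOpen_inter_preimage hWop
  refine IsCInf.of_local hop0 fun x hx => ?_
  obtain ⟨b, hb, hxb⟩ := hA (m (a.symm x.1))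
  have hop : IsOpen (a.target ∩ a.symm ⁻¹' (univ ∩ m ⁻¹' b.source)) :=
    a.symm.isOpen_inter_preimage (isOpen_univ.inter (b.open_source.preimage hmc))
  have h1 := ((hm.2 a ha b hb).isCInf hop).comp_clm (ContinuousLinearMap.fst ℝ E E)
  have hop' := (hop.preimage (continuous_fst (X := E) (Y := E))).inter hop0
  refine ⟨_, hop', ⟨⟨hx.1.1, mem_univ _, hxb⟩, hx⟩, ?_⟩
  have h2 : IsCInf (ContinuousLinearMap.snd ℝ E E) univ := ContinuousLinearMap.isCInf _ _
  have h3 := (h1.mono (inter_subset_left (t := (a.prod a').symm.source ∩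
    (a.prod a').symm ⁻¹' ((fun q : M × M => (m q.1, q.2)) ⁻¹' W)))).prodMk (h2.mono (subset_univ _))
  refine ((hf (b.prod a') ⟨b, hb, a', ha', rfl⟩).comp
    ((b.prod a').symm.isOpen_inter_preimage hW) h3 ?_).congr hop' ?_
  · intro y hy
    have h4 : b.symm (b (m (a.symm y.1))) = m (a.symm y.1) := b.left_inv hy.1.2.2
    refine ⟨⟨b.map_source hy.1.2.2, hy.2.1.2⟩, ?_⟩
    change (b.symm (b (m (a.symm y.1))), a'.symm y.2) ∈ W
    rw [h4]
    exact hy.2.2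
  · intro y hy
    have h4 : b.symm (b (m (a.symm y.1))) = m (a.symm y.1) := b.left_inv hy.1.2.2
    change f (b.symm (b (m (a.symm y.1))), a'.symm y.2) = f (m (a.symm y.1), a'.symm y.2)
    rw [h4]

theorem comp_snd (hf : IsSmoothVec A f U) :
    IsSmoothVec (prodAtlas A) (fun q : M × M => f q.2) (Prod.snd ⁻¹' U) := by
  rintro _ ⟨a, ha, a', ha', rfl⟩
  exact ((hf a' ha').comp_clm (ContinuousLinearMap.snd ℝ E E)).mono fun q hq => ⟨hq.1.2, hq.2⟩

theorem comp_fst (hf : IsSmoothVec A f U) :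
    IsSmoothVec (prodAtlas A) (fun q : M × M => f q.1) (Prod.fst ⁻¹' U) := by
  rintro _ ⟨a, ha, a', ha', rfl⟩
  exact ((hf a ha).comp_clm (ContinuousLinearMap.fst ℝ E E)).mono fun q hq => ⟨hq.1.1, hq.2⟩

theorem comp_prodMk_left [IsTopologicalAddGroup F] [ContinuousSMul ℝ F] [LocallyConvexSpace ℝ F]
    (hA : ∀ y, ∃ b ∈ A, y ∈ b.source) {f : M × M → F} {W : Set (M × M)}
    (hW : IsOpen W) (hf : IsSmoothVec (prodAtlas A) f W) (c : M) :
    IsSmoothVec A (fun x => f (c, x)) ((fun x => (c, x)) ⁻¹' W) := by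
  obtain ⟨b, hb, hcb⟩ := hA c
  intro a ha
  have h1 : IsCInf (ContinuousLinearMap.id ℝ E)
      (a.target ∩ a.symm ⁻¹' ((fun x => (c, x)) ⁻¹' W)) := ContinuousLinearMap.isCInf _ _
  have hbc : b.symm (b c) = c := b.left_inv hcb
  refine ((hf (b.prod a) ⟨b, hb, a, ha, rfl⟩).comp ((b.prod a).symm.isOpen_inter_preimage hW)
    ((isCInf_const (b c) _).prodMk h1) ?_).congr
    (a.symm.isOpen_inter_preimage (hW.preimage (by fun_prop))) ?_
  · intro y hy
    refine ⟨⟨b.map_source hcb, hy.1⟩, ?_⟩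
    change (b.symm (b c), a.symm y) ∈ W
    rw [hbc]
    exact hy.2
  · intro y hy
    change f (b.symm (b c), a.symm y) = f (c, a.symm y)
    rw [hbc]

/-- In a single chart a, the kernel read in the product chart a × a is the Gram kernel of the local
representative. -/
theorem of_kernel {H : Type w} [NormedAddCommGroup H] [InnerProductSpace ℂ H] [CompleteSpace H]
    {v : M → H} (hU : IsOpen U)
    (h : IsSmoothVec (prodAtlas A) (fun q : M × M => inner ℂ (v q.1) (v q.2)) (U ×ˢ U)) :
    IsSmoothVec A v U := by
  intro a ha
  refine IsCInf.of_kernel (a.symm.isOpen_inter_preimage hU) ?_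
  exact (h (a.prod a) ⟨a, ha, a, ha, rfl⟩).mono fun q hq =>
    ⟨⟨hq.1.1, hq.2.1⟩, ⟨hq.1.2, hq.2.2⟩⟩

end IsSmoothVec

variable [IsTopologicalAddGroup F] [ContinuousSMul ℝ F] [LocallyConvexSpace ℝ F] [T2Space F]

theorem isSmoothMapOn_singleton_iff {N : Type*} [TopologicalSpace N]
    {b : OpenPartialHomeomorph N F} {f : M → N} {U : Set M} (hU : IsOpen U) :
    IsSmoothMapOn A {b} f U ↔
      ContinuousOn f U ∧ IsSmoothVec A (fun x => b (f x)) (U ∩ f ⁻¹' b.source) := by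
  refine and_congr_right fun hc => ?_
  have hop : IsOpen (U ∩ f ⁻¹' b.source) := hc.isOpen_inter_preimage hU b.open_source
  refine forall₂_congr fun a ha => ?_
  simp only [mem_singleton_iff, forall_eq]
  exact isSmoothOn_iff_isCInf (a.symm.isOpen_inter_preimage hop)

theorem isSmoothMapOn_vectorAtlas_iff (hA : ∀ x, ∃ a ∈ A, x ∈ a.source) {f : M → F} {U : Set M}
    (hU : IsOpen U) : IsSmoothMapOn A (vectorAtlas F) f U ↔ IsSmoothVec A f U := by
  rw [vectorAtlas, isSmoothMapOn_singleton_iff hU]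
  simp only [OpenPartialHomeomorph.refl_source, preimage_univ, inter_univ,
    OpenPartialHomeomorph.refl_apply]
  exact and_iff_right_of_imp fun h => h.continuousOn hA hU

theorem exists_mem_prodAtlas (hA : ∀ x, ∃ a ∈ A, x ∈ a.source) (q : M × M) :
    ∃ c ∈ prodAtlas A, q ∈ c.source := by
  obtain ⟨a, ha, h1⟩ := hA q.1
  obtain ⟨b, hb, h2⟩ := hA q.2
  exact ⟨_, ⟨a, ha, b, hb, rfl⟩, h1, h2⟩

end Manifold

/-! ### Normalised lifts and the orbit map in affine coordinates -/

section Lifts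

variable {H : Type*} [NormedAddCommGroup H] [InnerProductSpace ℂ H] {G : Type*} [Group G]
  {ρ : G →* ProjUnitary H} {ψ : H}

theorem projAct_mul (u u' : ProjUnitary H) (x : ℙ ℂ H) :
    projAct (u * u') x = projAct u (projAct u' x) := by
  obtain ⟨U, rfl⟩ := QuotientGroup.mk_surjective u
  obtain ⟨U', rfl⟩ := QuotientGroup.mk_surjective u'
  induction x with
  | h χ hχ => rw [← QuotientGroup.mk_mul]; rfl

theorem IsNormalizedLift.projAct_eq {g : G} {U : H ≃ₗᵢ[ℂ] H} (hU : IsNormalizedLift ρ ψ g U)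
    (hψ : ψ ≠ 0) : projAct (ρ g) (.mk ℂ ψ hψ) = .mk ℂ (U ψ) (by simpa using hψ) := by
  rw [← hU.1, projAct_mk]

theorem IsNormalizedLift.inner_eq {g : G} {U : H ≃ₗᵢ[ℂ] H} (hU : IsNormalizedLift ρ ψ g U) :
    inner ℂ ψ (U ψ) = ((inner ℂ ψ (U ψ)).re : ℂ) :=
  Complex.ext (by simp) (by simpa using hU.2.2)

theorem IsNormalizedLift.inner_ne_zero {g : G} {U : H ≃ₗᵢ[ℂ] H} (hU : IsNormalizedLift ρ ψ g U) :
    inner ℂ ψ (U ψ) ≠ 0 := fun h => by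
  have := hU.2.1
  rw [h] at this
  exact lt_irrefl _ this

theorem IsNormalizedLift.transitionProb_eq {g : G} {U : H ≃ₗᵢ[ℂ] H}
    (hU : IsNormalizedLift ρ ψ g U) (hψ : ψ ≠ 0) :
    transitionProb (.mk ℂ ψ hψ) (projAct (ρ g) (.mk ℂ ψ hψ)) =
      (inner ℂ ψ (U ψ)).re ^ 2 / (‖ψ‖ ^ 2 * ‖ψ‖ ^ 2) := by
  rw [hU.projAct_eq hψ, transitionProb_mk, hU.inner_eq, Complex.norm_real, Real.norm_eq_abs, sq_abs,
    U.norm_map, Complex.ofReal_re]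

/-- The transition probability only knows the modulus of the matrix coefficient; positivity of the
coefficient is what recovers it. -/
theorem IsNormalizedLift.inner_eq_sqrt {g : G} {U : H ≃ₗᵢ[ℂ] H}
    (hU : IsNormalizedLift ρ ψ g U) (hψ : ψ ≠ 0) :
    inner ℂ ψ (U ψ) = ((‖ψ‖ ^ 2 *
      √(transitionProb (.mk ℂ ψ hψ) (projAct (ρ g) (.mk ℂ ψ hψ))) : ℝ) : ℂ) := by
  have h0 : ‖ψ‖ ≠ 0 := norm_ne_zero_iff.2 hψ
  have h1 : (inner ℂ ψ (U ψ)).re ^ 2 / (‖ψ‖ ^ 2 * ‖ψ‖ ^ 2) =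
      ((inner ℂ ψ (U ψ)).re / ‖ψ‖ ^ 2) ^ 2 := by
    field_simp
  rw [hU.transitionProb_eq hψ, h1, Real.sqrt_sq (div_nonneg hU.2.1.le (sq_nonneg _)),
    mul_div_cancel₀ _ (pow_ne_zero 2 h0)]
  exact hU.inner_eq

theorem IsNormalizedLift.mem_liftDomain {g : G} {U : H ≃ₗᵢ[ℂ] H} (hU : IsNormalizedLift ρ ψ g U)
    (hψ : ψ ≠ 0) : g ∈ liftDomain ρ ψ hψ := by
  have h0 : ‖ψ‖ ≠ 0 := norm_ne_zero_iff.2 hψ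
  change transitionProb _ _ ≠ 0
  rw [hU.transitionProb_eq hψ]
  exact div_ne_zero (pow_ne_zero 2 hU.2.1.ne') (mul_ne_zero (pow_ne_zero 2 h0) (pow_ne_zero 2 h0))

theorem IsNormalizedLift.normalizedLift_eq {g : G} {U : H ≃ₗᵢ[ℂ] H}
    (hU : IsNormalizedLift ρ ψ g U) (hψ : ψ ≠ 0) : normalizedLift ρ ψ g = U :=
  (existsUnique_normalizedLift ρ ψ hψ g (hU.mem_liftDomain hψ)).unique
    (normalizedLift_spec ρ ψ hψ g (hU.mem_liftDomain hψ)) hU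

/-- The matrix coefficient of the inverse is the complex conjugate, so positivity survives. -/
theorem IsNormalizedLift.inv {g : G} {U : H ≃ₗᵢ[ℂ] H} (hU : IsNormalizedLift ρ ψ g U) :
    IsNormalizedLift ρ ψ g⁻¹ U⁻¹ := by
  have h1 : inner ℂ ψ (U⁻¹ ψ) = starRingEnd ℂ (inner ℂ ψ (U ψ)) := by
    rw [inner_conj_symm, ← U.inner_map_map ψ (U⁻¹ ψ)]
    congr 1
    exact U.apply_symm_apply ψ
  refine ⟨by rw [QuotientGroup.mk_inv, hU.1, map_inv], ?_, ?_⟩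
  · rw [h1, Complex.conj_re]; exact hU.2.1
  · rw [h1, Complex.conj_im, hU.2.2, neg_zero]

theorem isNormalizedLift_one (hψ : ψ ≠ 0) : IsNormalizedLift ρ ψ 1 1 := by
  have h1 : inner ℂ ψ ((1 : H ≃ₗᵢ[ℂ] H) ψ) = ((‖ψ‖ ^ 2 : ℝ) : ℂ) := by
    change inner ℂ ψ ψ = _
    rw [inner_self_eq_norm_sq_to_K]
    push_cast
    rfl
  refine ⟨by rw [QuotientGroup.mk_one, map_one], ?_, ?_⟩
  · rw [h1, Complex.ofReal_re]; exact pow_pos (norm_pos_iff.2 hψ) 2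
  · rw [h1, Complex.ofReal_im]

theorem one_mem_liftDomain (hψ : ψ ≠ 0) : (1 : G) ∈ liftDomain ρ ψ hψ :=
  (isNormalizedLift_one hψ).mem_liftDomain hψ

theorem inv_mem_liftDomain {hψ : ψ ≠ 0} {g : G} (hg : g ∈ liftDomain ρ ψ hψ) :
    g⁻¹ ∈ liftDomain ρ ψ hψ :=
  (normalizedLift_spec ρ ψ hψ g hg).inv.mem_liftDomain hψ

theorem normalizedLift_inv {hψ : ψ ≠ 0} {g : G} (hg : g ∈ liftDomain ρ ψ hψ) :
    normalizedLift ρ ψ g⁻¹ = (normalizedLift ρ ψ g)⁻¹ :=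
  (normalizedLift_spec ρ ψ hψ g hg).inv.normalizedLift_eq hψ

/-- The Gram kernel of the normalised orbit map in terms of the local cocycle. -/
theorem inner_normalizedLift_inv {hψ : ψ ≠ 0} {q : G × G} (hq : q ∈ cocycleDomain ρ ψ hψ) :
    inner ℂ (normalizedLift ρ ψ q.1⁻¹ ψ) (normalizedLift ρ ψ q.2 ψ) =
      localCocycle ρ ψ q * inner ℂ ψ (normalizedLift ρ ψ (q.1 * q.2) ψ) := by
  have h1 := congrArg (fun U : H ≃ₗᵢ[ℂ] H => U ψ) (localCocycle_spec ρ ψ hψ q hq)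
  have h2 : normalizedLift ρ ψ q.1 (normalizedLift ρ ψ q.2 ψ) =
      (localCocycle ρ ψ q : ℂ) • normalizedLift ρ ψ (q.1 * q.2) ψ := h1
  rw [normalizedLift_inv hq.1, ← (normalizedLift ρ ψ q.1).inner_map_map, h2, inner_smul_right]
  congr 2
  exact (normalizedLift ρ ψ q.1).apply_symm_apply ψ

theorem mem_liftDomain_iff_inner_rep_ne_zero {hψ : ψ ≠ 0} {g : G} :
    g ∈ liftDomain ρ ψ hψ ↔ inner ℂ ψ (projAct (ρ g) (.mk ℂ ψ hψ)).rep ≠ 0 := by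
  obtain ⟨U, hU⟩ := QuotientGroup.mk_surjective (ρ g)
  have h0 : ‖ψ‖ ≠ 0 := norm_ne_zero_iff.2 hψ
  rw [liftDomain, mem_ofPred_eq, ← hU, projAct_mk, transitionProb_mk, Ne, Ne, inner_rep_eq_zero_iff]
  simp [h0]

/-- The normalised orbit map in terms of the affine coordinate of the orbit. -/
theorem normalizedLift_apply_eq {hψ : ψ ≠ 0} {g : G} (hg : g ∈ liftDomain ρ ψ hψ) :
    normalizedLift ρ ψ g ψ =
      (‖ψ‖ / ‖ψ + (affineCoord ψ (projAct (ρ g) (.mk ℂ ψ hψ)) : H)‖) •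
        (ψ + (affineCoord ψ (projAct (ρ g) (.mk ℂ ψ hψ)) : H)) := by
  have hU := normalizedLift_spec ρ ψ hψ g hg
  set U := normalizedLift ρ ψ g
  have h0 : ‖ψ‖ ≠ 0 := norm_ne_zero_iff.2 hψ
  rw [hU.projAct_eq hψ, affineCoord_apply _ hU.inner_ne_zero, add_sub_cancel, hU.inner_eq]
  have hr := hU.2.1
  set r := (inner ℂ ψ (U ψ)).re
  -- The affine representative is a positive real multiple of U ψ, so rescaling it to norm ‖ψ‖ gives
  -- back U ψ without a phase.
  have h1 : ((‖ψ‖ : ℂ) ^ 2 / (r : ℂ)) • U ψ = (‖ψ‖ ^ 2 / r) • U ψ := by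
    rw [← Complex.coe_smul]
    push_cast
    rfl
  have h2 : 0 ≤ ‖ψ‖ ^ 2 / r := by positivity
  rw [h1, norm_smul, Real.norm_of_nonneg h2, U.norm_map, smul_smul]
  have h3 : ‖ψ‖ / (‖ψ‖ ^ 2 / r * ‖ψ‖) * (‖ψ‖ ^ 2 / r) = 1 := by
    field_simp
  rw [h3, one_smul]

end Lifts

section ContDiff

variable {H : Type*} [NormedAddCommGroup H] [InnerProductSpace ℂ H]

theorem contDiffOn_affineCoord (φ : H) : ContDiffOn ℝ (⊤ : ℕ∞)
    (fun χ : H => (ℂ ∙ φ)ᗮ.orthogonalProjectionOnto (((‖φ‖ : ℂ) ^ 2 / inner ℂ φ χ) • χ))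
    {χ | inner ℂ φ χ ≠ 0} := by
  have h1 : ContDiff ℝ (⊤ : ℕ∞) (fun χ : H => inner ℂ φ χ) := contDiff_const.inner ℂ contDiff_id
  have h2 : ContDiffOn ℝ (⊤ : ℕ∞) (fun χ : H => (‖φ‖ : ℂ) ^ 2 / inner ℂ φ χ)
      {χ | inner ℂ φ χ ≠ 0} := by
    simp only [div_eq_mul_inv]
    exact contDiffOn_const.mul (h1.contDiffOn.inv fun _ h => h)
  exact (((ℂ ∙ φ)ᗮ.orthogonalProjectionOnto).restrictScalars ℝ).contDiff.comp_contDiffOn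
    (h2.smul contDiffOn_id)

theorem contDiff_normalized_add {ψ : H} (hψ : ψ ≠ 0) : ContDiff ℝ (⊤ : ℕ∞)
    (fun u : (ℂ ∙ ψ)ᗮ => (‖ψ‖ / ‖ψ + (u : H)‖) • (ψ + (u : H))) := by
  have h1 : ContDiff ℝ (⊤ : ℕ∞) (fun u : (ℂ ∙ ψ)ᗮ => ψ + (u : H)) :=
    contDiff_const.add (((ℂ ∙ ψ)ᗮ.subtypeL).restrictScalars ℝ).contDiff
  have h2 : ContDiff ℝ (⊤ : ℕ∞) (fun u : (ℂ ∙ ψ)ᗮ => ‖ψ + (u : H)‖) :=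
    h1.norm ℂ fun u => add_orthogonal_ne_zero hψ u
  exact (contDiff_const.div h2 fun u => norm_ne_zero_iff.2 (add_orthogonal_ne_zero hψ u)).smul h1

end ContDiff

/-! ### Orbit maps and the smoothness criterion -/

section OrbitMaps

variable {H : Type*} [NormedAddCommGroup H] [InnerProductSpace ℂ H]
  {E : Type*} [AddCommGroup E] [Module ℝ E] [TopologicalSpace E] [IsTopologicalAddGroup E]
  [ContinuousSMul ℝ E]

theorem projChart_apply (φ : {v : H // v ≠ 0}) (x : ℙ ℂ H) :
    projChart φ x = affineCoord (φ : H) x := rfl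

theorem projChart_source (φ : {v : H // v ≠ 0}) :
    (projChart φ).source = {x | inner ℂ (φ : H) x.rep ≠ 0} := rfl

/-- A map to the projective space that locally lifts to a smooth map to the Hilbert space is
smooth. -/
theorem isSmoothToProjOn_univ_of_lift {M : Type*} [TopologicalSpace M]
    {A : Set (OpenPartialHomeomorph M E)} (hA : ∀ x, ∃ a ∈ A, x ∈ a.source) {f : M → ℙ ℂ H}
    (h : ∀ x, ∃ V, IsOpen V ∧ x ∈ V ∧ ∃ (w : M → H) (hw : ∀ y, w y ≠ 0), IsSmoothVec A w V ∧
      ∀ y ∈ V, f y = .mk ℂ (w y) (hw y)) :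
    IsSmoothToProjOn A f univ := by
  have hcont : Continuous f := by
    rw [continuous_iff_continuousAt]
    intro x
    obtain ⟨V, hV, hxV, w, hw, hws, hfw⟩ := h x
    have h1 : ContinuousAt (fun y => (⟨w y, hw y⟩ : {v : H // v ≠ 0})) x :=
      ((hws.continuousOn hA hV).continuousAt (hV.mem_nhds hxV)).codRestrict hw
    have h2 : ContinuousAt (fun y => Projectivization.mk' ℂ ⟨w y, hw y⟩) x :=
      (isQuotientMap_mk'.continuous.continuousAt).comp h1
    refine h2.congr ?_
    filter_upwards [hV.mem_nhds hxV] with y hy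
    exact (hfw y hy).symm
  intro φ
  rw [isSmoothMapOn_singleton_iff isOpen_univ]
  have hop : IsOpen (univ ∩ f ⁻¹' (projChart φ).source) :=
    isOpen_univ.inter ((projChart φ).open_source.preimage hcont)
  refine ⟨hcont.continuousOn, IsSmoothVec.of_local hop fun x hx => ?_⟩
  obtain ⟨V, hV, hxV, w, hw, hws, hfw⟩ := h x
  refine ⟨_, hop.inter hV, ⟨hx, hxV⟩, ?_⟩
  have hopen : IsOpen {χ : H | inner ℂ (φ : H) χ ≠ 0} :=
    isOpen_ne_fun (by fun_prop) continuous_const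
  refine ((hws.mono inter_subset_right).comp_isCInf hopen
    ((contDiffOn_affineCoord (φ : H)).isCInf hopen) ?_).congr (hop.inter hV) ?_
  · rintro y ⟨⟨-, hy⟩, hyV⟩
    rw [mem_preimage, projChart_source, mem_ofPred_eq, hfw y hyV, Ne, inner_rep_eq_zero_iff] at hy
    exact hy
  · rintro y ⟨-, hyV⟩
    simp only [projChart_apply]
    rw [hfw y hyV, affineCoord_mk]

variable [LocallyConvexSpace ℝ E] [T2Space E]
  {G : Type*} [TopologicalSpace G] [ChartedSpace E G] [Group G] [LocallyConvexLieGroup E G]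
  {ρ : G →* ProjUnitary H} {ψ : H}

theorem exists_mem_atlas (E : Type*) [TopologicalSpace E] {M : Type*} [TopologicalSpace M]
    [ChartedSpace E M] (x : M) : ∃ a ∈ atlas E M, x ∈ a.source :=
  ⟨chartAt E x, chart_mem_atlas E x, mem_chart_source E x⟩

theorem LocallyConvexLieGroup.continuous_mul (E G : Type*) [AddCommGroup E] [Module ℝ E]
    [TopologicalSpace E] [TopologicalSpace G] [ChartedSpace E G] [Group G]
    [LocallyConvexLieGroup E G] : Continuous fun q : G × G => q.1 * q.2 :=
  continuousOn_univ.1 (LocallyConvexLieGroup.smooth_mul (E := E) (G := G)).1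

theorem LocallyConvexLieGroup.continuous_inv (E G : Type*) [AddCommGroup E] [Module ℝ E]
    [TopologicalSpace E] [TopologicalSpace G] [ChartedSpace E G] [Group G]
    [LocallyConvexLieGroup E G] : Continuous fun g : G => g⁻¹ :=
  continuousOn_univ.1 (LocallyConvexLieGroup.smooth_inv (E := E) (G := G)).1

section Pullback

variable {F : Type*} [AddCommGroup F] [Module ℝ F] [TopologicalSpace F] [IsTopologicalAddGroup F]
  [ContinuousSMul ℝ F] [LocallyConvexSpace ℝ F] [T2Space F]

theorem IsSmoothVec.comp_mul {f : G → F} {U : Set G} (hU : IsOpen U)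
    (hf : IsSmoothVec (atlas E G) f U) : IsSmoothVec (prodAtlas (atlas E G))
      (fun q : G × G => f (q.1 * q.2)) ((fun q : G × G => q.1 * q.2) ⁻¹' U) :=
  hf.comp_isSmoothMapOn (exists_mem_atlas E) LocallyConvexLieGroup.smooth_mul hU

theorem IsSmoothVec.comp_inv {f : G → F} {U : Set G} (hU : IsOpen U)
    (hf : IsSmoothVec (atlas E G) f U) : IsSmoothVec (atlas E G)
      (fun g => f g⁻¹) ((fun g : G => g⁻¹) ⁻¹' U) :=
  hf.comp_isSmoothMapOn (exists_mem_atlas E) LocallyConvexLieGroup.smooth_inv hU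

theorem IsSmoothVec.comp_inv_fst {f : G × G → F} {W : Set (G × G)} (hW : IsOpen W)
    (hf : IsSmoothVec (prodAtlas (atlas E G)) f W) : IsSmoothVec (prodAtlas (atlas E G))
      (fun q : G × G => f (q.1⁻¹, q.2)) ((fun q : G × G => (q.1⁻¹, q.2)) ⁻¹' W) :=
  hf.comp_prodMap_id (exists_mem_atlas E) LocallyConvexLieGroup.smooth_inv hW

theorem IsSmoothVec.comp_mul_left {f : G → F} {U : Set G} (hU : IsOpen U)
    (hf : IsSmoothVec (atlas E G) f U) (c : G) :
    IsSmoothVec (atlas E G) (fun g => f (c * g)) ((fun g => c * g) ⁻¹' U) :=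
  (hf.comp_mul hU).comp_prodMk_left (exists_mem_atlas E)
    (hU.preimage (LocallyConvexLieGroup.continuous_mul E G)) c

end Pullback

/-- Only continuity at 1 is used: the transition probability is nonzero at 1, hence near 1, and
multiplication is continuous. -/
theorem mem_nhds_cocycleDomain {hψ : ψ ≠ 0} (hp : TransitionProbSmoothNearOne E ρ ψ hψ) :
    cocycleDomain ρ ψ hψ ∈ 𝓝 ((1 : G), (1 : G)) := by
  obtain ⟨U, hU, h1U, hp, -⟩ := hp
  have h1 : liftDomain ρ ψ hψ ∈ 𝓝 (1 : G) :=
    (hp.continuousAt (hU.mem_nhds h1U)).eventually_ne (one_mem_liftDomain hψ)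
  have h2 := (LocallyConvexLieGroup.continuous_mul E G).tendsto (1, 1)
  rw [mul_one] at h2
  filter_upwards [(continuous_fst.tendsto ((1 : G), (1 : G))).eventually h1,
    (continuous_snd.tendsto ((1 : G), (1 : G))).eventually h1, h2.eventually h1] with q ha hb hc
  exact ⟨ha, hb, hc⟩

/-- The orbit map is smooth if the normalised orbit map is smooth near `1`. -/
theorem isSmoothRay_of_normalizedLift {hψ : ψ ≠ 0} {V : Set G} (hV : IsOpen V) (h1V : 1 ∈ V)
    (hVD : V ⊆ liftDomain ρ ψ hψ)
    (hv : IsSmoothVec (atlas E G) (fun g => normalizedLift ρ ψ g ψ) V) :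
    IsSmoothRay E ρ (.mk ℂ ψ hψ) := by
  refine isSmoothToProjOn_univ_of_lift (exists_mem_atlas E) fun g₀ => ?_
  obtain ⟨R, hR⟩ := QuotientGroup.mk_surjective (ρ g₀)
  have hop : IsOpen ((fun g => g₀⁻¹ * g) ⁻¹' V) :=
    hV.preimage ((LocallyConvexLieGroup.continuous_mul E G).comp (continuous_const.prodMk continuous_id))
  -- Near g₀ the orbit is the image under one fixed unitary R, an arbitrary lift of ρ(g₀), of the
  -- orbit near 1.
  refine ⟨_, hop, ?_, fun g => R (normalizedLift ρ ψ (g₀⁻¹ * g) ψ), fun g => by simpa using hψ,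
    ?_, ?_⟩
  · rw [mem_preimage, inv_mul_cancel]
    exact h1V
  · exact (hv.comp_mul_left hV g₀⁻¹).comp_isCInf isOpen_univ
      ((((R : H →L[ℂ] H)).restrictScalars ℝ).isCInf univ) (mapsTo_univ _ _)
  · intro g hg
    have h1 := (normalizedLift_spec ρ ψ hψ _ (hVD hg)).projAct_eq hψ
    rw [← mul_inv_cancel_left g₀ g, map_mul, projAct_mul, h1, ← hR, projAct_mk]
    simp only [mul_inv_cancel_left]

theorem IsSmoothRay.isOpen_liftDomain {hψ : ψ ≠ 0} (h : IsSmoothRay E ρ (.mk ℂ ψ hψ)) :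
    IsOpen (liftDomain ρ ψ hψ) := by
  have h1 := (projChart ⟨ψ, hψ⟩).open_source.preimage (continuousOn_univ.1 (h ⟨ψ, hψ⟩).1)
  convert h1 using 1
  ext g
  exact mem_liftDomain_iff_inner_rep_ne_zero

/-- On this domain the orbit stays in the chart at ψ, and the normalised vector is a smooth function
of the chart coordinate. -/
theorem IsSmoothRay.isSmoothVec_normalizedLift {hψ : ψ ≠ 0}
    (h : IsSmoothRay E ρ (.mk ℂ ψ hψ)) :
    IsSmoothVec (atlas E G) (fun g => normalizedLift ρ ψ g ψ) (liftDomain ρ ψ hψ) := by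
  have h1 := ((isSmoothMapOn_singleton_iff isOpen_univ).1 (h ⟨ψ, hψ⟩)).2
  have h2 := (h1.mono (V := liftDomain ρ ψ hψ) fun g hg =>
    ⟨mem_univ _, mem_liftDomain_iff_inner_rep_ne_zero.1 hg⟩).comp_isCInf isOpen_univ
    ((contDiff_normalized_add hψ).contDiffOn.isCInf isOpen_univ) (mapsTo_univ _ _)
  exact h2.congr h.isOpen_liftDomain fun g hg => (normalizedLift_apply_eq hg).symm

theorem IsSmoothRay.transitionProbSmoothNearOne {hψ : ψ ≠ 0}
    (h : IsSmoothRay E ρ (.mk ℂ ψ hψ)) : TransitionProbSmoothNearOne E ρ ψ hψ := by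
  refine ⟨_, h.isOpen_liftDomain, one_mem_liftDomain hψ, ?_⟩
  rw [isSmoothMapOn_vectorAtlas_iff (exists_mem_atlas E) h.isOpen_liftDomain]
  have h1 : ContDiff ℝ (⊤ : ℕ∞)
      (fun w : H => (inner ℂ ψ w).re ^ 2 / (‖ψ‖ ^ 2 * ‖ψ‖ ^ 2)) :=
    ((Complex.reCLM.contDiff.comp (contDiff_const.inner ℂ contDiff_id)).pow 2).div_const _
  refine (h.isSmoothVec_normalizedLift.comp_isCInf isOpen_univ
    (h1.contDiffOn.isCInf isOpen_univ) (mapsTo_univ _ _)).congr h.isOpen_liftDomain fun g hg => ?_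
  exact ((normalizedLift_spec ρ ψ hψ g hg).transitionProb_eq hψ).symm

/-- The Gram kernel identity is solved for the cocycle: with v the normalised orbit map, f_ψ(g, h) =
⟨v(g⁻¹), v(h)⟩ / ⟨ψ, v(gh)⟩, and the denominator never vanishes on the domain of the cocycle. -/
theorem IsSmoothRay.localCocycleSmoothNearOne {hψ : ψ ≠ 0}
    (h : IsSmoothRay E ρ (.mk ℂ ψ hψ)) : LocalCocycleSmoothNearOne E ρ ψ hψ := by
  have hmul := LocallyConvexLieGroup.continuous_mul E G
  have hD := h.isOpen_liftDomain
  have hop : IsOpen (cocycleDomain ρ ψ hψ) :=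
    (hD.preimage continuous_fst).inter ((hD.preimage continuous_snd).inter (hD.preimage hmul))
  have h1D := one_mem_liftDomain (ρ := ρ) hψ
  refine ⟨_, hop, ⟨h1D, h1D, by simpa using h1D⟩, subset_rfl, ?_⟩
  rw [isSmoothMapOn_vectorAtlas_iff (exists_mem_prodAtlas (exists_mem_atlas E)) hop]
  have hv := h.isSmoothVec_normalizedLift
  have h1 : IsSmoothVec (prodAtlas (atlas E G)) (fun q : G × G => normalizedLift ρ ψ q.1⁻¹ ψ)
      (cocycleDomain ρ ψ hψ) := by
    refine (hv.comp_inv hD).comp_fst.mono fun q hq => ?_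
    rw [mem_preimage, mem_preimage]
    exact inv_mem_liftDomain hq.1
  have h2 := hv.comp_snd.mono (V := cocycleDomain ρ ψ hψ) fun q hq => hq.2.1
  have h3 := (hv.comp_mul hD).mono (V := cocycleDomain ρ ψ hψ) fun q hq => hq.2.2
  have hopen : IsOpen {w : (H × H) × H | inner ℂ ψ w.2 ≠ 0} :=
    isOpen_ne_fun (by fun_prop) continuous_const
  have hφ : ContDiffOn ℝ (⊤ : ℕ∞)
      (fun w : (H × H) × H => inner ℂ w.1.1 w.1.2 * (inner ℂ ψ w.2)⁻¹)
      {w | inner ℂ ψ w.2 ≠ 0} := by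
    have ha : ContDiff ℝ (⊤ : ℕ∞) (fun w : (H × H) × H => inner ℂ w.1.1 w.1.2) :=
      (contDiff_fst.comp contDiff_fst).inner ℂ (contDiff_snd.comp contDiff_fst)
    have hb : ContDiff ℝ (⊤ : ℕ∞) (fun w : (H × H) × H => inner ℂ ψ w.2) :=
      contDiff_const.inner ℂ contDiff_snd
    exact ha.contDiffOn.mul (hb.contDiffOn.inv fun _ hw => hw)
  have h4 := (h1.prodMk h2).prodMk h3
  have h5 : IsCInf (fun w : (H × H) × H => inner ℂ w.1.1 w.1.2 * (inner ℂ ψ w.2)⁻¹)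
      {w | inner ℂ ψ w.2 ≠ 0} := hφ.isCInf hopen
  have h6 := h4.comp_isCInf hopen h5
    fun q hq => (normalizedLift_spec ρ ψ hψ _ hq.2.2).inner_ne_zero
  refine h6.congr hop fun q hq => ?_
  have h7 := (normalizedLift_spec ρ ψ hψ _ hq.2.2).inner_ne_zero
  simp only [inner_normalizedLift_inv hq]
  rw [mul_assoc, mul_inv_cancel₀ h7, mul_one]

theorem isSmoothRay_of_transitionProb_of_localCocycle [CompleteSpace H] {hψ : ψ ≠ 0}
    (hp : TransitionProbSmoothNearOne E ρ ψ hψ) (hf : LocalCocycleSmoothNearOne E ρ ψ hψ) :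
    IsSmoothRay E ρ (.mk ℂ ψ hψ) := by
  have hmul := LocallyConvexLieGroup.continuous_mul E G
  have hinv := LocallyConvexLieGroup.continuous_inv E G
  obtain ⟨U, hU, h1U, hp⟩ := hp
  obtain ⟨W, hW, h1W, hWD, hf⟩ := hf
  rw [isSmoothMapOn_vectorAtlas_iff (exists_mem_atlas E) hU] at hp
  rw [isSmoothMapOn_vectorAtlas_iff (exists_mem_prodAtlas (exists_mem_atlas E)) hW] at hf
  -- Here the transition probability is smooth at gh, and it is nonzero because W lies in the domain
  -- of the cocycle; so its square root is smooth as well.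
  have hW₁ : IsOpen (W ∩ (fun q : G × G => q.1 * q.2) ⁻¹' U) := hW.inter (hU.preimage hmul)
  have hopen : IsOpen {z : ℂ × ℝ | z.2 ≠ 0} := isOpen_ne_fun continuous_snd continuous_const
  have hφ : ContDiffOn ℝ (⊤ : ℕ∞) (fun z : ℂ × ℝ => z.1 * ((‖ψ‖ ^ 2 * √z.2 : ℝ) : ℂ))
      {z | z.2 ≠ 0} :=
    contDiffOn_fst.mul (Complex.ofRealCLM.contDiff.comp_contDiffOn
      (contDiffOn_const.mul (contDiffOn_snd.sqrt fun _ h => h)))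
  have hk := ((hf.mono (inter_subset_left (t := (fun q : G × G => q.1 * q.2) ⁻¹' U))).prodMk
    ((hp.comp_mul hU).mono inter_subset_right)).comp_isCInf hopen (hφ.isCInf hopen)
    fun q hq => (hWD hq.1).2.2
  have hk' := hk.congr (g := fun q : G × G =>
    inner ℂ (normalizedLift ρ ψ q.1⁻¹ ψ) (normalizedLift ρ ψ q.2 ψ)) hW₁ fun q hq => by
      simp only [inner_normalizedLift_inv (hWD hq.1),
        (normalizedLift_spec ρ ψ hψ _ (hWD hq.1).2.2).inner_eq_sqrt hψ]
  -- Substituting g⁻¹ for g turns the identity into one for the true Gram kernel (g, h) ↦ ⟨v(g),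
  -- v(h)⟩.
  have hK := hk'.comp_inv_fst hW₁
  simp only [inv_inv] at hK
  have hinv' : Continuous fun q : G × G => (q.1⁻¹, q.2) := by fun_prop
  have h1 : ((1 : G), (1 : G)) ∈ (fun q : G × G => (q.1⁻¹, q.2)) ⁻¹'
      (W ∩ (fun q : G × G => q.1 * q.2) ⁻¹' U) := by
    simpa using And.intro h1W h1U
  -- The kernel criterion needs a square V × V; its diagonal points also show that V lies in the
  -- lift domain.
  obtain ⟨V, hV, h1V, hVW⟩ := exists_nhds_square ((hW₁.preimage hinv').mem_nhds h1)
  refine isSmoothRay_of_normalizedLift hV h1V (fun g hg => ?_) (.of_kernel hV (hK.mono hVW))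
  exact (hWD (hVW (mk_mem_prod hg hg)).1).2.1

end OrbitMaps

theorem theorem5p2 {E G H : Type*}
    [AddCommGroup E] [Module ℝ E] [TopologicalSpace E] [IsTopologicalAddGroup E]
    [ContinuousSMul ℝ E] [LocallyConvexSpace ℝ E] [T2Space E]
    [TopologicalSpace G] [ChartedSpace E G] [Group G] [LocallyConvexLieGroup E G]
    [NormedAddCommGroup H] [InnerProductSpace ℂ H] [CompleteSpace H]
    (ρ : G →* ProjUnitary H) (ψ : H) (hψ : ψ ≠ 0) :
    (TransitionProbSmoothNearOne E ρ ψ hψ → cocycleDomain ρ ψ hψ ∈ 𝓝 ((1 : G), (1 : G))) ∧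
    (IsSmoothRay E ρ (Projectivization.mk ℂ ψ hψ) ↔
      TransitionProbSmoothNearOne E ρ ψ hψ ∧ LocalCocycleSmoothNearOne E ρ ψ hψ) :=
  ⟨mem_nhds_cocycleDomain,
    fun h => ⟨h.transitionProbSmoothNearOne, h.localCocycleSmoothNearOne⟩,
    fun h => isSmoothRay_of_transitionProb_of_localCocycle h.1 h.2⟩
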